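/- **Setting.** Fix $d,K,m\ge 1$ and $K$ distinct points $S^0=\{t_1,\dots,t_K\}\subset\mathbb R^d$; let $\Delta=\min_{k\ne\ell}\|t_k-t_\ell\|_2$ (with $\Delta=+\infty$ if $K=1$) and $\Delta_+=\min(\Delta,1)$. With $\operatorname{sinc}(x)=\sin(x)/x$ ($\operatorname{sinc}(0)=1$) put $\psi(u)=\prod_{j=1}^d\operatorname{sinc}(u^j)$, $\psi_m(u)=\psi(mu)^4$, and for $\alpha\in\mathbb R^K$, $\beta_1,\dots,\beta_K\in\mathbb R^d$ $$p_m^{\alpha,\beta}(t)=\sum_{k=1}^K\big\{\alpha_k\psi_m(t-t_k)+\langle\beta_k,\nabla\psi_m(t-t_k)\rangle\big\}.$$ The Fourier transform is $\mathcal F[f](\omega)=\int_{\mathbb R^d}e^{-i\langle x,\omega\rangle}f(x)\,dx$, and $\mathcal F^{-1}[g](x)=(2\pi)^{-d}\int_{\mathbb R^d}e^{i\langle x,\omega\rangle}g(\omega)\,d\omega$. **Theorem.** There are universal constants $C,\upsilon,\gamma,\mathcal C,A>0$ such that for all $d,K,m$ and $t_1,\dots,t_K$ as above with $m\ge C\sqrt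 K\,d^{3/2}/\Delta_+$ there are $\alpha,\beta$ for which $P_m=(p_m^{\alpha,\beta})^2$ satisfies the following. (i) $P_m(t_k)=1$ for all $k$, $0\le P_m\le 1$ on $\mathbb R^d$, and $P_m(t)=1$ if and only if $t\in S^0$. (ii) Let $\epsilon=\upsilon/(md)$. For every $k$ and every $t$ with $\|t-t_k\|_2\le\epsilon$, $0\le P_m(t)\le 1-\mathcal C m^2\|t-t_k\|_2^2$. For every $t$ with $\|t-t_k\|_2>\epsilon$ for all $k$, $0\le P_m(t)\le 1-\gamma\upsilon^2/d^3$. (iii) $P_m$ is integrable, $\operatorname{Supp}(\mathcal F[P_m])\subset[-8m,8m]^d$, and $\|P_m\|_{L^2(\mathbb R^d)}\le A^d K^2 m^{-d/2}$. (iv) Let $\varphi$ be a probability density on $\mathbb R^d$ which is a bounded continuous symmetric function of positive definite type and whose Fourier transform $\sigma=\mathcal F[\varphi]$ vanishes nowhere on $[-8m,8m]^d$. Let $\lambda:\mathbb R^d\to\mathbb R$ be a bounded continuous symmetric function of positive definite type with $\lambda=\mathcal F^{-1}[\ell]$ for some nonnegative integrable $\ell$ that is bounded below by a positive constant almost everywhere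 on $[-8m,8m]^d$, and let $\mathbb L$ be the reproducing kernel Hilbert space of real functions on $\mathbb R^d$ with kernel $(x,y)\mapsto\lambda(x-y)$. Then there is $c\in\mathbb L$ with $P_m=\Phi c$, where $\Phi c=\varphi\star c=\int\varphi(\cdot-y)c(y)\,dy$ (the integral converging absolutely at every point). -/

import Mathlib

open MeasureTheory

namespace StrongCertificate

/-- `ℝ^d` with its Euclidean norm. -/
abbrev E (d : ℕ) := EuclideanSpace ℝ (Fin d)

/-- The cube `[-R, R]^d`. -/
def cube (d : ℕ) (R : ℝ) : Set (E d) := {ω | ∀ j, |ω j| ≤ R}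

/-- `ψ(u) = ∏ⱼ sinc(uʲ)`, where `sinc x = sin x / x` and `sinc 0 = 1`. -/
noncomputable def psi {d : ℕ} (u : E d) : ℝ := ∏ j, Real.sinc (u j)

/-- `ψ_m(u) = ψ(m u)⁴`. -/
noncomputable def psiM {d : ℕ} (m : ℕ) (u : E d) : ℝ := psi ((m : ℝ) • u) ^ 4

/-- `p_m^{α,β}(s) = ∑ₖ (αₖ ψ_m(s - tₖ) + ⟨βₖ, ∇ψ_m(s - tₖ)⟩)`. -/
noncomputable def pM {d K : ℕ} (m : ℕ) (t : Fin K → E d) (α : Fin K → ℝ) (β : Fin K → E d)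
    (s : E d) : ℝ :=
  ∑ k, (α k * psiM m (s - t k) + inner ℝ (β k) (gradient (psiM m) (s - t k)))

/-- `Δ₊ = min(Δ, 1)`, with `Δ` the minimal distance between two distinct points of the family.
For a single point `Δ = ∞`, hence `Δ₊ = 1`. -/
noncomputable def sepPlus {d K : ℕ} (t : Fin K → E d) : ℝ :=
  (min (Set.einfsep (Set.range t)) 1).toReal

/-- The near region around one point: the closed ball of radius `ε`. -/
def nearRegion {d K : ℕ} (t : Fin K → E d) (ε : ℝ) (k : Fin K) : Set (E d) :=
  {s | ‖s - t k‖ ≤ ε}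

/-- The far region: the complement of the union of the near regions. -/
def farRegion {d K : ℕ} (t : Fin K → E d) (ε : ℝ) : Set (E d) :=
  (⋃ k, nearRegion t ε k)ᶜ

/-- The Fourier transform `𝓕[f](ω) = ∫ exp(-i ⟨x, ω⟩) f(x) dx` (angular frequencies). -/
noncomputable def fourierT {d : ℕ} (f : E d → ℝ) (ω : E d) : ℂ :=
  ∫ x : E d, Complex.exp (-(Complex.I * ((inner ℝ x ω : ℝ) : ℂ))) * (f x : ℂ)

/-- The inverse Fourier transform `(2π)^{-d} ∫ exp(i ⟨x, ω⟩) g(ω) dω`. -/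
noncomputable def invFourierT {d : ℕ} (g : E d → ℝ) (x : E d) : ℂ :=
  ((2 * Real.pi : ℂ) ^ d)⁻¹ *
    ∫ ω : E d, Complex.exp (Complex.I * ((inner ℝ x ω : ℝ) : ℂ)) * (g ω : ℂ)

open scoped ComplexOrder in
/-- Bounded continuous symmetric function of positive definite type. -/
structure IsPosDefKernel {d : ℕ} (φ : E d → ℝ) : Prop where
  bounded : ∃ M : ℝ, ∀ x, |φ x| ≤ M
  continuous : Continuous φ
  symmetric : ∀ x, φ (-x) = φ x
  posDef : ∀ (n : ℕ) (x : Fin n → E d) (z : Fin n → ℂ),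
    0 ≤ ∑ i, ∑ j, (φ (x i - x j) : ℂ) * z i * starRingEnd ℂ (z j)

/-- Probability density with respect to Lebesgue measure. -/
structure IsProbDensity {d : ℕ} (φ : E d → ℝ) : Prop where
  nonneg : ∀ x, 0 ≤ φ x
  integrable : Integrable φ
  integral_eq_one : ∫ x, φ x = 1

/-- The spectrum `σ = 𝓕[φ]` does not vanish on `[-η, η]^d`. (For an integrable bounded continuous
symmetric function of positive definite type, `φ = 𝓕⁻¹[σ]` and the evenness of `σ` are
automatic.) -/
def SpectrumCovers {d : ℕ} (φ : E d → ℝ) (η : ℝ) : Prop :=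
  cube d η ⊆ {ω | fourierT φ ω ≠ 0}

/-- `l` is a nonnegative integrable function whose inverse Fourier transform is `lam`, that is,
`l = 𝓕[lam]`. The function `lam` itself need not be integrable. -/
structure IsSpectralDensity {d : ℕ} (lam l : E d → ℝ) : Prop where
  nonneg : ∀ ω, 0 ≤ l ω
  integrable : Integrable l
  eq_inv : ∀ x, (lam x : ℂ) = invFourierT l x

/-- The Hilbert space `H` of real functions on `ℝ^d` with continuous point evaluations has
reproducing kernel `(x, y) ↦ lam (x - y)`. -/
def HasReproducingKernel {d : ℕ} (lam : E d → ℝ) (H : Type) [NormedAddCommGroup H]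
    [InnerProductSpace ℝ H] [CompleteSpace H] [RKHS ℝ H (E d) ℝ] : Prop :=
  ∀ x y : E d, RKHS.kernel H x y 1 = lam (x - y)

/-- `P = Φ c`, where `Φ c = φ ⋆ c = ∫ φ(· - y) c(y) dy`, the integrals being convergent. -/
def IsConvolution {d : ℕ} (φ c P : E d → ℝ) : Prop :=
  ∀ x, Integrable (fun y => φ (x - y) * c y) ∧ P x = ∫ y, φ (x - y) * c y

end StrongCertificate

open StrongCertificate

/-! Put `τ k = m • t k`. Up to scaling, `P` is the square of a function `q`, a combination of
translates of `ψ⁴` and of its first partial derivatives, which solves a Hermite problem: value 1 and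
gradient 0 at every node. The hypothesis on `m` separates the nodes by `2 * sepScale d K * √d`, and
the derivatives of `sinc⁴` used here decay like `|x|⁻⁴`. Distinct nodes therefore interact by at
most `h = (sepScale d K)⁻⁴`. The linear system is diagonally dominant, and its solution is close to
the trivial choice of coefficient 1 on `ψ⁴` and 0 on its derivatives (`exists_interpolant`).

Consequently, near any one node `q` agrees with a single bump `ψ⁴(· - τ k)` up to second
derivatives, within `2⁻³⁰ / d³` (`abs_interpolant_sub_le_of_sep`). The Hessian of the bump at its
centre is `-(4/3)` times the identity, so `q` has a strict quadratic maximum on the ball of radius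
`1 / (2048 d)` (`interpolant_near`). Outside these balls some coordinate relative to the nearest
node is at least `1 / (2048 d^(3/2))`, and the loss in one factor `sinc⁴` beats the error
(`interpolant_far`). As `ψ⁴ ≥ 0`, `q` stays well above `-1`, so both upper bounds survive squaring.

On the Fourier side, `sinc²` is the transform of a tent, so `sinc⁴` and its derivative have angular
band 4. Tensor products, translates and sums keep this band, squaring doubles it, and dilation
multiplies it by `m`: this gives `8m`. Integrating the decay profile bounds the `L²` norm.

For (iv), divide the transform of `P` by that of `φ` on the band and invert. The resulting function
has a compactly supported bounded spectrum, on which the spectral density of the kernel is bounded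
below. This makes evaluation against it bounded in the RKHS norm, so Hahn–Banach and Riesz place it
in the space (`exists_rkhs_of_fourierInv`, `exists_isConvolution`). -/

namespace StrongCertificate

/-! ### Derivatives of `sinc` and `sinc⁴`: decay, values at the origin, upper bounds. -/

/-- The `n`-th derivative of `sinc`, as an integral. -/
noncomputable def sincDeriv (n : ℕ) (x : ℝ) : ℝ :=
  ∫ s in (0:ℝ)..1, s ^ n * Real.cos (x * s + n * (Real.pi / 2))

lemma hasDerivAt_sincDeriv (n : ℕ) (x : ℝ) :
    HasDerivAt (sincDeriv n) (sincDeriv (n + 1) x) x := by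
  have h := intervalIntegral.hasDerivAt_integral_of_dominated_loc_of_deriv_le
    (μ := volume) (a := 0) (b := 1) (bound := fun _ => 1)
    (F := fun x s => s ^ n * Real.cos (x * s + n * (Real.pi / 2)))
    (F' := fun x s => s ^ (n + 1) * Real.cos (x * s + (n + 1 : ℕ) * (Real.pi / 2)))
    (x₀ := x) (s := Set.univ) Filter.univ_mem ?_ ?_ ?_ ?_ ?_ ?_
  · exact h.2
  · exact Filter.Eventually.of_forall fun y =>
      (Continuous.aestronglyMeasurable (by fun_prop))
  · exact (Continuous.intervalIntegrable (by fun_prop) _ _)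
  · exact (Continuous.aestronglyMeasurable (by fun_prop))
  · refine Filter.Eventually.of_forall fun s hs y _ => ?_
    rw [Set.uIoc_of_le zero_le_one] at hs
    rw [norm_mul, norm_pow, Real.norm_eq_abs, Real.norm_eq_abs, abs_of_pos hs.1]
    exact mul_le_one₀ (pow_le_one₀ hs.1.le hs.2) (abs_nonneg _) (Real.abs_cos_le_one _)
  · exact intervalIntegrable_const
  · refine Filter.Eventually.of_forall fun s hs y _ => ?_
    have h1 : HasDerivAt (fun x => x * s + n * (Real.pi / 2)) s y := by
      simpa using ((hasDerivAt_id y).mul_const s).add_const (n * (Real.pi / 2))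
    refine ((h1.cos).const_mul (s ^ n)).congr_deriv ?_
    rw [show y * s + ((n + 1 : ℕ) : ℝ) * (Real.pi / 2)
      = (y * s + n * (Real.pi / 2)) + Real.pi / 2 by push_cast; ring, Real.cos_add_pi_div_two]
    ring

lemma abs_sincDeriv_le_one (n : ℕ) (x : ℝ) : |sincDeriv n x| ≤ 1 := by
  have := intervalIntegral.norm_integral_le_of_norm_le_const (a := 0) (b := 1) (C := 1)
    (f := fun s => s ^ n * Real.cos (x * s + n * (Real.pi / 2))) (fun s hs => by
      rw [Set.uIoc_of_le zero_le_one] at hs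
      rw [norm_mul, norm_pow, Real.norm_eq_abs, Real.norm_eq_abs, abs_of_pos hs.1]
      exact mul_le_one₀ (pow_le_one₀ hs.1.le hs.2) (abs_nonneg _) (Real.abs_cos_le_one _))
  simpa [sincDeriv] using this

lemma sincDeriv_zero_left (x : ℝ) : sincDeriv 0 x = Real.sinc x := by
  rcases eq_or_ne x 0 with rfl | hx
  · simp [sincDeriv]
  · rw [Real.sinc_of_ne_zero hx, sincDeriv]
    simp [intervalIntegral.integral_comp_mul_left (fun y => Real.cos y) hx]
    field_simp

/-- This is `x * sinc x = sin x` differentiated `n + 1` times. Since `sincDeriv n` is bounded, it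
forces every derivative of `sinc` to decay like `1 / |x|`. -/
lemma sincDeriv_recurrence (n : ℕ) (x : ℝ) :
    x * sincDeriv (n + 1) x + (n + 1) * sincDeriv n x = Real.cos (x + n * (Real.pi / 2)) := by
  induction n generalizing x with
  | zero =>
    have h : (fun x : ℝ => x * sincDeriv 0 x) = Real.sin := by
      funext y
      rw [sincDeriv_zero_left]
      rcases eq_or_ne y 0 with rfl | hy
      · simp
      · rw [Real.sinc_of_ne_zero hy]; field_simp
    have h1 := (hasDerivAt_id x).mul (hasDerivAt_sincDeriv 0 x)
    have h2 : HasDerivAt (fun x : ℝ => x * sincDeriv 0 x) (Real.cos x) x := h ▸ Real.hasDerivAt_sin x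
    have := h1.unique h2
    simp at this ⊢
    linarith
  | succ n ih =>
    have h1 := ((hasDerivAt_id x).mul (hasDerivAt_sincDeriv (n + 1) x)).add
      ((hasDerivAt_sincDeriv n x).const_mul ((n : ℝ) + 1))
    have h2 : HasDerivAt (fun x : ℝ => Real.cos (x + n * (Real.pi / 2)))
        (Real.cos (x + (n + 1 : ℕ) * (Real.pi / 2))) x := by
      refine (((hasDerivAt_id x).add_const (n * (Real.pi / 2))).cos).congr_deriv ?_
      rw [show x + ((n + 1 : ℕ) : ℝ) * (Real.pi / 2)
        = (x + n * (Real.pi / 2)) + Real.pi / 2 by push_cast; ring, Real.cos_add_pi_div_two]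
      simp
    rw [← funext ih] at h2
    have := h1.unique h2
    rw [← this]
    push_cast
    simp
    ring

lemma abs_mul_sincDeriv_le (n : ℕ) (x : ℝ) : |x| * |sincDeriv n x| ≤ n + 1 := by
  rw [← abs_mul]
  cases n with
  | zero =>
    rw [sincDeriv_zero_left]
    rcases eq_or_ne x 0 with rfl | hx
    · simp
    · rw [Real.sinc_of_ne_zero hx, mul_div_cancel₀ _ hx]
      simpa using Real.abs_sin_le_one x
  | succ n =>
    have h := sincDeriv_recurrence n x
    have h1 := abs_le.1 (Real.abs_cos_le_one (x + n * (Real.pi / 2)))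
    have h2 := abs_le.1 (abs_sincDeriv_le_one n x)
    have hn : (0 : ℝ) ≤ n := n.cast_nonneg
    rw [abs_le]
    push_cast
    constructor <;> nlinarith

/-- The decay profile `max(1, |x|)⁻⁴`. -/
noncomputable def decay (x : ℝ) : ℝ := ((max 1 |x|) ^ 4)⁻¹

lemma max_one_abs_pos (x : ℝ) : 0 < max 1 |x| := lt_max_of_lt_left one_pos

lemma decay_pos (x : ℝ) : 0 < decay x := inv_pos.2 (pow_pos (max_one_abs_pos x) 4)

lemma decay_le_one (x : ℝ) : decay x ≤ 1 :=
  inv_le_one_of_one_le₀ (one_le_pow₀ (le_max_left _ _))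

lemma abs_sincDeriv_le (n : ℕ) (x : ℝ) : |sincDeriv n x| ≤ (n + 1) * (max 1 |x|)⁻¹ := by
  rw [← div_eq_mul_inv, le_div_iff₀ (max_one_abs_pos x), mul_max_of_nonneg _ _ (abs_nonneg _)]
  refine max_le ?_ ?_
  · have := abs_sincDeriv_le_one n x
    have hn : (0 : ℝ) ≤ n := n.cast_nonneg
    linarith
  · rw [mul_comm]; exact abs_mul_sincDeriv_le n x

/-- The derivatives of `sinc⁴`. -/
noncomputable def sincFour (n : ℕ) : ℝ → ℝ := iteratedDeriv n (fun x => Real.sinc x ^ 4)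

lemma contDiff_sinc : ContDiff ℝ (⊤ : ℕ∞) Real.sinc := by
  have h : ∀ n, iteratedDeriv n Real.sinc = sincDeriv n := by
    intro n
    induction n with
    | zero => rw [iteratedDeriv_zero]; exact (funext sincDeriv_zero_left).symm
    | succ n ih => rw [iteratedDeriv_succ, ih]; exact funext fun x => (hasDerivAt_sincDeriv n x).deriv
  refine contDiff_of_differentiable_iteratedDeriv fun n _ => ?_
  rw [h]
  exact fun x => (hasDerivAt_sincDeriv n x).differentiableAt

lemma hasDerivAt_sincFour (n : ℕ) (x : ℝ) : HasDerivAt (sincFour n) (sincFour (n + 1) x) x := by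
  have h : ContDiff ℝ (⊤ : ℕ∞) (fun x => Real.sinc x ^ 4) := contDiff_sinc.pow 4
  have hd : Differentiable ℝ (sincFour n) :=
    (h.differentiable_iteratedDeriv n (by exact_mod_cast WithTop.coe_lt_top _))
  have := (hd x).hasDerivAt
  rwa [sincFour, ← iteratedDeriv_succ] at this

lemma sincFour_zero (x : ℝ) : sincFour 0 x = Real.sinc x ^ 4 := by
  simp [sincFour]

lemma sincFour_zero' (x : ℝ) : sincFour 0 x = sincDeriv 0 x ^ 4 := by
  rw [sincFour_zero, sincDeriv_zero_left]

lemma sincFour_one (x : ℝ) : sincFour 1 x = 4 * sincDeriv 0 x ^ 3 * sincDeriv 1 x := by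
  have h := (hasDerivAt_sincDeriv 0 x).pow 4
  have h2 := hasDerivAt_sincFour 0 x
  rw [funext sincFour_zero'] at h2
  rw [h2.unique h]; norm_num

lemma sincFour_two (x : ℝ) : sincFour 2 x =
    12 * sincDeriv 0 x ^ 2 * sincDeriv 1 x ^ 2 + 4 * sincDeriv 0 x ^ 3 * sincDeriv 2 x := by
  have h := (((hasDerivAt_sincDeriv 0 x).pow 3).const_mul 4).mul (hasDerivAt_sincDeriv 1 x)
  have h2 := hasDerivAt_sincFour 1 x
  rw [funext sincFour_one] at h2
  rw [h2.unique h]; norm_num; ring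

lemma sincFour_three (x : ℝ) : sincFour 3 x =
    24 * sincDeriv 0 x * sincDeriv 1 x ^ 3 +
      36 * sincDeriv 0 x ^ 2 * sincDeriv 1 x * sincDeriv 2 x +
      4 * sincDeriv 0 x ^ 3 * sincDeriv 3 x := by
  have h := ((((hasDerivAt_sincDeriv 0 x).pow 2).const_mul 12).mul
    ((hasDerivAt_sincDeriv 1 x).pow 2)).add
    ((((hasDerivAt_sincDeriv 0 x).pow 3).const_mul 4).mul (hasDerivAt_sincDeriv 2 x))
  have h2 := hasDerivAt_sincFour 2 x
  rw [funext sincFour_two] at h2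
  rw [h2.unique h]; norm_num; ring

/-- Each Leibniz term is a product of four derivatives of `sinc`, the `k`-th one at most `(k + 1) *
r` with `r = (max 1 |x|)⁻¹`. The totals are 1, 8, 60 and 424. Order 3 is the highest needed: second
derivatives of the first-derivative generators. -/
lemma abs_sincFour_le (n : ℕ) (hn : n ≤ 3) (x : ℝ) : |sincFour n x| ≤ 8 ^ n * decay x := by
  have h0 := abs_sincDeriv_le 0 x
  have h1 := abs_sincDeriv_le 1 x
  have h2 := abs_sincDeriv_le 2 x
  have h3 := abs_sincDeriv_le 3 x
  have hr : decay x = (max 1 |x|)⁻¹ ^ 4 := by rw [decay, inv_pow]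
  have hr0 : 0 < (max 1 |x|)⁻¹ := inv_pos.2 (max_one_abs_pos x)
  rw [hr]
  generalize (max 1 |x|)⁻¹ = r at *
  norm_num at h0 h1 h2 h3
  interval_cases n
  · rw [sincFour_zero', abs_pow, pow_zero, one_mul]
    gcongr
  · rw [sincFour_one, abs_mul, abs_mul, abs_pow]
    calc |(4:ℝ)| * |sincDeriv 0 x| ^ 3 * |sincDeriv 1 x| ≤ |(4:ℝ)| * r ^ 3 * (2 * r) := by gcongr
      _ = _ := by norm_num; ring
  · rw [sincFour_two]
    refine (abs_add_le _ _).trans ?_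
    simp only [abs_mul, abs_pow]
    calc _ ≤ |(12:ℝ)| * r ^ 2 * (2 * r) ^ 2 + |(4:ℝ)| * r ^ 3 * (3 * r) := by gcongr
      _ = 60 * r ^ 4 := by norm_num; ring
      _ ≤ _ := by gcongr; norm_num
  · rw [sincFour_three]
    refine (abs_add_three _ _ _).trans ?_
    simp only [abs_mul, abs_pow]
    calc _ ≤ |(24:ℝ)| * r * (2 * r) ^ 3 + |(36:ℝ)| * r ^ 2 * (2 * r) * (3 * r)
          + |(4:ℝ)| * r ^ 3 * (4 * r) := by gcongr
      _ = 424 * r ^ 4 := by norm_num; ring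
      _ ≤ _ := by gcongr; norm_num

lemma sincFour_zero_zero : sincFour 0 0 = 1 := by simp [sincFour_zero]

lemma sincFour_one_zero : sincFour 1 0 = 0 := by
  simp [sincFour_one, sincDeriv]

lemma sincFour_two_zero : sincFour 2 0 = -(4 / 3) := by
  have h : sincDeriv 2 0 = -(1 / 3) := by
    simp [sincDeriv, mul_div_cancel₀]
    norm_num
  rw [sincFour_two, h]
  simp [sincDeriv]
  norm_num

lemma sincFour_zero_nonneg (x : ℝ) : 0 ≤ sincFour 0 x := by rw [sincFour_zero]; positivity

lemma sincFour_zero_le_one (x : ℝ) : sincFour 0 x ≤ 1 :=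
  (le_abs_self _).trans ((abs_sincFour_le 0 (by norm_num) x).trans (by simpa using decay_le_one x))

lemma abs_sinc_le {x y : ℝ} (hy : 0 ≤ y) (hy1 : y ≤ 1) (hx : y ≤ |x|) :
    |Real.sinc x| ≤ 1 - y ^ 2 / 48 := by
  wlog hx0 : 0 ≤ x generalizing x
  · rw [← Real.sinc_neg]
    exact this (by rwa [abs_neg]) (by linarith)
  rw [abs_of_nonneg hx0] at hx
  rcases eq_or_lt_of_le hx0 with rfl | hx0
  · rw [le_antisymm hx hy]; simp
  -- For `x ≤ 2` the half-angle formula halves the argument, bringing it into `[0, 1]`, where the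
  -- cubic Taylor bound for `sin` applies. For `x ≥ 2`, `|sin x| / x ≤ 1 / 2` suffices.
  rcases le_total x 2 with h2 | h2
  · have hs : Real.sinc x = Real.sinc (x / 2) * Real.cos (x / 2) := by
      rw [Real.sinc_of_ne_zero hx0.ne', Real.sinc_of_ne_zero (by positivity)]
      conv_lhs => rw [show x = 2 * (x / 2) by ring, Real.sin_two_mul]
      field_simp
    have h3 : |Real.sinc x| ≤ |Real.sinc (x / 2)| := by
      rw [hs, abs_mul]
      exact mul_le_of_le_one_right (abs_nonneg _) (Real.abs_cos_le_one _)
    have h4 : |Real.sinc (x / 2)| ≤ 1 - (x / 2) ^ 2 / 12 := by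
      have hz : 0 < x / 2 := by positivity
      have hz1 : x / 2 ≤ 1 := by linarith
      generalize x / 2 = z at *
      have hb := Real.sin_bound (x := z) (by rwa [abs_of_pos hz])
      rw [abs_of_pos hz, abs_le] at hb
      rw [Real.sinc_of_ne_zero hz.ne', abs_div, abs_of_pos hz, div_le_iff₀ hz,
        abs_of_nonneg (Real.sin_nonneg_of_nonneg_of_le_pi hz.le (by linarith [Real.pi_gt_three]))]
      have : z ^ 4 ≤ z ^ 3 := pow_le_pow_of_le_one hz.le hz1 (by norm_num)
      nlinarith [hb.2, pow_pos hz 3]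
    nlinarith
  · rw [Real.sinc_of_ne_zero hx0.ne', abs_div, abs_of_pos hx0, div_le_iff₀ hx0]
    have := Real.abs_sin_le_one x
    have h47 : (47 : ℝ) / 48 ≤ 1 - y ^ 2 / 48 := by nlinarith
    nlinarith

lemma sincFour_zero_le {x y : ℝ} (hy : 0 ≤ y) (hy1 : y ≤ 1) (hx : y ≤ |x|) :
    sincFour 0 x ≤ 1 - y ^ 2 / 48 := by
  refine le_trans ?_ (abs_sinc_le hy hy1 hx)
  rw [sincFour_zero, show Real.sinc x ^ 4 = |Real.sinc x| ^ 4 by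
    rw [← abs_pow, abs_of_nonneg (by positivity)]]
  exact pow_le_of_le_one (abs_nonneg _) (Real.abs_sinc_le_one x) (by norm_num)

/-- Mean value estimate for the derivatives of `sinc⁴` at the origin. -/
lemma abs_sincFour_sub_le (n : ℕ) (hn : n ≤ 2) (x : ℝ) :
    |sincFour n x - sincFour n 0| ≤ 8 ^ (n + 1) * |x| := by
  have := Convex.norm_image_sub_le_of_norm_hasDerivWithin_le (s := Set.univ) (f := sincFour n)
    (f' := sincFour (n + 1)) (C := 8 ^ (n + 1)) (x := 0) (y := x)
    (fun y _ => (hasDerivAt_sincFour n y).hasDerivWithinAt)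
    (fun y _ => (abs_sincFour_le (n + 1) (by omega) y).trans
      (mul_le_of_le_one_right (by positivity) (decay_le_one y)))
    convex_univ trivial trivial
  simpa using this

/-! ### Mixed partial derivatives of the tensor product `ψ⁴` and their decay. -/

/-- The mixed partial derivatives of `ψ⁴`. -/
noncomputable def partialD {d : ℕ} (n : Fin d → ℕ) (v : E d) : ℝ := ∏ j, sincFour (n j) (v j)

/-- The product decay profile on `ℝ^d`. -/
noncomputable def decayProd {d : ℕ} (v : E d) : ℝ := ∏ j, decay (v j)

lemma partialD_zero {d : ℕ} (v : E d) : partialD 0 v = psi v ^ 4 := by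
  simp [partialD, psi, sincFour_zero, Finset.prod_pow]

lemma hasFDerivAt_partialD {d : ℕ} (n : Fin d → ℕ) (v : E d) :
    HasFDerivAt (partialD n)
      (∑ i, partialD (n + Pi.single i 1) v • (EuclideanSpace.proj i : E d →L[ℝ] ℝ)) v := by
  have h := HasFDerivAt.finsetProd (u := Finset.univ) (x := v)
    (g := fun (j : Fin d) (v : E d) => sincFour (n j) (v j))
    (g' := fun j => sincFour (n j + 1) (v j) • (EuclideanSpace.proj j : E d →L[ℝ] ℝ))
    (fun j _ => (hasDerivAt_sincFour (n j) (v j)).comp_hasFDerivAt v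
      (EuclideanSpace.proj j : E d →L[ℝ] ℝ).hasFDerivAt)
  refine h.congr_fderiv (Finset.sum_congr rfl fun i _ => ?_)
  rw [smul_smul]
  congr 1
  rw [partialD, ← Finset.mul_prod_erase _ _ (Finset.mem_univ i), mul_comm]
  congr 1
  · simp
  · refine Finset.prod_congr rfl fun j hj => ?_
    simp [Finset.ne_of_mem_erase hj]

lemma continuous_partialD {d : ℕ} (n : Fin d → ℕ) : Continuous (partialD n) :=
  continuous_iff_continuousAt.2 fun v => (hasFDerivAt_partialD n v).continuousAt

lemma hasDerivAt_partialD_line {d : ℕ} (n : Fin d → ℕ) (u w : E d) (s : ℝ) :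
    HasDerivAt (fun s : ℝ => partialD n (u + s • w))
      (∑ i, w i * partialD (n + Pi.single i 1) (u + s • w)) s := by
  have h1 : HasDerivAt (fun s : ℝ => u + s • w) w s := by
    simpa using ((hasDerivAt_id s).smul_const w).const_add u
  refine ((hasFDerivAt_partialD n _).comp_hasDerivAt s h1).congr_deriv ?_
  simp [mul_comm]

lemma decayProd_pos {d : ℕ} (v : E d) : 0 < decayProd v := Finset.prod_pos fun _ _ => decay_pos _

lemma decayProd_le {d : ℕ} (v : E d) (j : Fin d) : decayProd v ≤ decay (v j) := by
  rw [decayProd, ← Finset.mul_prod_erase _ _ (Finset.mem_univ j)]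
  exact mul_le_of_le_one_right (decay_pos _).le
    (Finset.prod_le_one (fun _ _ => (decay_pos _).le) fun _ _ => decay_le_one _)

lemma decayProd_le_one {d : ℕ} (v : E d) : decayProd v ≤ 1 :=
  Finset.prod_le_one (fun _ _ => (decay_pos _).le) fun _ _ => decay_le_one _

lemma abs_partialD_le {d : ℕ} (n : Fin d → ℕ) (hn : ∑ j, n j ≤ 3) (v : E d) :
    |partialD n v| ≤ 8 ^ (∑ j, n j) * decayProd v := by
  rw [partialD, Finset.abs_prod, decayProd, ← Finset.prod_pow_eq_pow_sum,
    ← Finset.prod_mul_distrib]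
  refine Finset.prod_le_prod (fun _ _ => abs_nonneg _) fun j _ => abs_sincFour_le _ ?_ _
  exact (Finset.single_le_sum (fun i _ => Nat.zero_le _) (Finset.mem_univ j)).trans hn

/-- The product profile is controlled by the decay in a single coordinate, so Euclidean distance
must be converted to a large coordinate. This accounts for the factor `√d` in the separation. -/
lemma exists_coord_ge {d : ℕ} (hd : 1 ≤ d) (v : E d) {r : ℝ} (hr : 0 ≤ r)
    (h : r * √d ≤ ‖v‖) : ∃ j, r ≤ |v j| := by
  by_contra! hc
  have : Nonempty (Fin d) := ⟨⟨0, hd⟩⟩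
  have h1 : ‖v‖ ^ 2 < d * r ^ 2 := by
    rw [EuclideanSpace.norm_sq_eq]
    calc ∑ i, ‖v i‖ ^ 2 < ∑ _i : Fin d, r ^ 2 :=
          Finset.sum_lt_sum_of_nonempty Finset.univ_nonempty fun i _ =>
            pow_lt_pow_left₀ (hc i) (abs_nonneg _) (by norm_num)
      _ = _ := by simp
  have h2 : (r * √d) ^ 2 ≤ ‖v‖ ^ 2 := by gcongr
  rw [mul_pow, Real.sq_sqrt d.cast_nonneg] at h2
  linarith

lemma decay_le_of_le_abs {x r : ℝ} (hr : 0 < r) (h : r ≤ |x|) : decay x ≤ (r ^ 4)⁻¹ := by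
  rw [decay]
  gcongr
  exact h.trans (le_max_right _ _)

lemma decayProd_le_of_le_norm {d : ℕ} (hd : 1 ≤ d) (v : E d) {r : ℝ} (hr : 0 < r)
    (h : r * √d ≤ ‖v‖) : decayProd v ≤ (r ^ 4)⁻¹ := by
  obtain ⟨j, hj⟩ := exists_coord_ge hd v hr.le h
  exact (decayProd_le v j).trans (decay_le_of_le_abs hr hj)

/-- The multi-index of an optional first-order partial derivative. -/
def optIdx {d : ℕ} (o : Option (Fin d)) : Fin d → ℕ := o.elim 0 fun i => Pi.single i 1

lemma optIdx_none {d : ℕ} : optIdx (none : Option (Fin d)) = 0 := rfl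
lemma optIdx_some {d : ℕ} (i : Fin d) : optIdx (some i) = Pi.single i 1 := rfl

lemma sum_optIdx_le {d : ℕ} (o : Option (Fin d)) : ∑ j, optIdx o j ≤ 1 := by
  cases o <;> simp [optIdx_none, optIdx_some]

/-- As `sinc⁴` is even, its first derivative vanishes at 0, so the block of the interpolation matrix
belonging to a single node is diagonal. -/
lemma partialD_origin {d : ℕ} (o o' : Option (Fin d)) :
    partialD (optIdx o + optIdx o') (0 : E d) =
      if o = o' then (if o = none then 1 else -(4 / 3)) else 0 := by
  have key : ∀ n : Fin d → ℕ, ∀ i, n i = 1 → partialD n (0 : E d) = 0 := fun n i h =>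
    Finset.prod_eq_zero (Finset.mem_univ i) (by simp [h, sincFour_one_zero])
  rcases o with _ | i <;> rcases o' with _ | j
  · simp [partialD, optIdx_none, sincFour_zero_zero]
  · rw [key _ j (by simp [optIdx_none, optIdx_some])]; simp
  · rw [key _ i (by simp [optIdx_none, optIdx_some])]; simp
  · by_cases h : i = j
    · subst h
      rw [partialD, Finset.prod_eq_single i]
      · simp [optIdx_some, sincFour_two_zero]
      · intro k _ hk; simp [optIdx_some, hk, sincFour_zero_zero]
      · simp
    · rw [key _ i (by simp [optIdx_some, h])]; simp [h]

/-! ### The Hermite interpolation system and its perturbation estimate. -/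

/-- A strictly diagonally dominant system has a solution close to the right-hand side. -/
lemma exists_solution_of_diag_dominant {ι : Type*} [Fintype ι] [DecidableEq ι] (A : Matrix ι ι ℝ)
    (e : ι → ℝ) {δ : ℝ} (hdiag : ∀ i, 1 ≤ |A i i|) (he : ∀ i, A i i * e i = e i)
    (hrow : ∀ i, ∑ j ∈ Finset.univ.erase i, |A i j| ≤ 1 / 2)
    (hrhs : ∀ i, ∑ j ∈ Finset.univ.erase i, |A i j| * |e j| ≤ δ) :
    ∃ x : ι → ℝ, (∀ i, ∑ j, A i j * x j = e i) ∧ ∀ i, |x i - e i| ≤ 2 * δ := by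
  have hdet : A.det ≠ 0 := det_ne_zero_of_sum_row_lt_diag fun i => by
    have h1 := hrow i
    have h2 := hdiag i
    simp only [Real.norm_eq_abs]
    linarith
  refine ⟨A⁻¹.mulVec e, fun i => ?_, ?_⟩
  · have : A.mulVec (A⁻¹.mulVec e) = e := by
      rw [Matrix.mulVec_mulVec, Matrix.mul_nonsing_inv _ (isUnit_iff_ne_zero.2 hdet),
        Matrix.one_mulVec]
    exact congrFun this i
  · have hsol : ∀ i, ∑ j, A i j * (A⁻¹.mulVec e) j = e i := fun i => by
      have : A.mulVec (A⁻¹.mulVec e) = e := by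
        rw [Matrix.mulVec_mulVec, Matrix.mul_nonsing_inv _ (isUnit_iff_ne_zero.2 hdet),
          Matrix.one_mulVec]
      exact congrFun this i
    generalize A⁻¹.mulVec e = x at hsol
    intro i₀
    have : Nonempty ι := ⟨i₀⟩
    -- At the index of the largest error, `A i i * e i = e i` leaves only off-diagonal terms. They
    -- contribute `δ` plus at most half of that same error, which is absorbed.
    obtain ⟨i, hi⟩ := Finite.exists_max fun i => |x i - e i|
    refine (hi i₀).trans ?_
    have h1 : A i i * (x i - e i) = -∑ j ∈ Finset.univ.erase i, A i j * (e j + (x j - e j)) := by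
      have := hsol i
      rw [← Finset.add_sum_erase _ _ (Finset.mem_univ i)] at this
      simp only [add_sub_cancel]
      linarith [he i]
    have h2 : |x i - e i| ≤ |A i i * (x i - e i)| := by
      rw [abs_mul]
      exact le_mul_of_one_le_left (abs_nonneg _) (hdiag i)
    have h3 : |A i i * (x i - e i)| ≤ δ + 1 / 2 * |x i - e i| := by
      rw [h1, abs_neg]
      refine (Finset.abs_sum_le_sum_abs _ _).trans ?_
      calc ∑ j ∈ Finset.univ.erase i, |A i j * (e j + (x j - e j))|
          ≤ ∑ j ∈ Finset.univ.erase i, (|A i j| * |e j| + |A i j| * |x i - e i|) := by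
            refine Finset.sum_le_sum fun j _ => ?_
            rw [abs_mul, ← mul_add]
            exact mul_le_mul_of_nonneg_left ((abs_add_le _ _).trans (by linarith [hi j]))
              (abs_nonneg _)
        _ ≤ _ := by
            rw [Finset.sum_add_distrib, ← Finset.sum_mul]
            gcongr
            · exact hrhs i
            · exact hrow i
    linarith

/-- The target values of the interpolation problem. -/
def target {d : ℕ} (o : Option (Fin d)) : ℝ := if o = none then 1 else 0

lemma abs_target {d : ℕ} (o : Option (Fin d)) : |target o| = target o := by
  unfold target; split_ifs <;> simp

lemma target_nonneg {d : ℕ} (o : Option (Fin d)) : 0 ≤ target o := by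
  unfold target; split_ifs <;> simp

lemma sum_target {d : ℕ} : ∑ o : Option (Fin d), target o = 1 := by
  simp [target]

/-- The derivative of multi-index `n` of the generalized interpolant with nodes `τ` and
coefficients `x`. -/
noncomputable def interpolant {d K : ℕ} (τ : Fin K → E d) (x : Fin K × Option (Fin d) → ℝ)
    (n : Fin d → ℕ) (v : E d) : ℝ :=
  ∑ p, x p * partialD (optIdx p.2 + n) (v - τ p.1)

lemma sum_add_idx {d : ℕ} (o : Option (Fin d)) (n : Fin d → ℕ) :
    ∑ j, (optIdx o + n) j ≤ 1 + ∑ j, n j := by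
  simp only [Pi.add_apply, Finset.sum_add_distrib]
  have := sum_optIdx_le o
  omega

lemma abs_partialD_optIdx_le {d : ℕ} (o : Option (Fin d)) (n : Fin d → ℕ) {k : ℕ}
    (hn : ∑ j, n j ≤ k) (hk : k ≤ 2) (v : E d) :
    |partialD (optIdx o + n) v| ≤ 8 ^ (1 + k) * decayProd v := by
  have h := sum_add_idx o n
  refine (abs_partialD_le _ (by omega) v).trans ?_
  refine mul_le_mul_of_nonneg_right (pow_le_pow_right₀ (by norm_num) (by omega))
    (decayProd_pos v).le

/-- Unknowns and conditions share the index set of pairs (node, optional direction), so the system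
is square. Off-diagonal entries vanish within a node and are at most `64 * h` across nodes, with `64
= 8²` for total order at most 2. The diagonal entry is 1 exactly where the target is nonzero. As the
targets at a node sum to 1, `δ = K * (64 * h)` carries no factor `d`. -/
lemma exists_interpolant {d K : ℕ} (τ : Fin K → E d) {h : ℝ} (hh : 0 ≤ h)
    (hτ : ∀ l k, l ≠ k → decayProd (τ l - τ k) ≤ h)
    (hsmall : K * ((d : ℝ) + 1) * (64 * h) ≤ 1 / 2) :
    ∃ x : Fin K × Option (Fin d) → ℝ,
      (∀ l o, interpolant τ x (optIdx o) (τ l) = target o) ∧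
      ∀ p, |x p - target p.2| ≤ 128 * K * h := by
  have hoff : ∀ p p' : Fin K × Option (Fin d), p' ≠ p →
      |partialD (optIdx p'.2 + optIdx p.2) (τ p.1 - τ p'.1)| ≤ 64 * h := by
    rintro ⟨l, o⟩ ⟨k, o'⟩ hne
    by_cases hlk : l = k
    · subst hlk
      have ho : o' ≠ o := fun ho => hne (by rw [ho])
      simp only [sub_self, partialD_origin, ho, if_false, abs_zero]
      positivity
    · refine (abs_partialD_optIdx_le o' _ (sum_optIdx_le o) (by norm_num) _).trans ?_
      norm_num
      exact hτ l k hlk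
  refine Exists.imp (fun x hx => ?_) (exists_solution_of_diag_dominant
    (A := fun p p' : Fin K × Option (Fin d) =>
      partialD (optIdx p'.2 + optIdx p.2) (τ p.1 - τ p'.1))
    (e := fun p => target p.2) (δ := K * (64 * h)) ?_ ?_ ?_ ?_)
  · refine ⟨fun l o => ?_, fun p => (hx.2 p).trans (by linarith)⟩
    rw [← hx.1 (l, o), interpolant]
    exact Finset.sum_congr rfl fun p _ => mul_comm _ _
  · rintro ⟨l, o⟩
    simp only [sub_self, partialD_origin, if_true]
    split_ifs
    · simp
    · rw [abs_neg, abs_of_pos] <;> norm_num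
  · rintro ⟨l, o⟩
    simp only [sub_self, partialD_origin, if_true, target]
    split_ifs <;> simp
  · intro p
    refine (Finset.sum_le_sum fun p' hp' => hoff p p' (Finset.ne_of_mem_erase hp')).trans ?_
    refine (Finset.sum_le_sum_of_subset_of_nonneg (Finset.erase_subset _ _)
      fun _ _ _ => by positivity).trans ?_
    simpa using hsmall
  · intro p
    refine (Finset.sum_le_sum fun p' hp' => mul_le_mul_of_nonneg_right
      (hoff p p' (Finset.ne_of_mem_erase hp')) (abs_nonneg _)).trans ?_
    refine (Finset.sum_le_sum_of_subset_of_nonneg (Finset.erase_subset _ _)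
      fun _ _ _ => by positivity).trans ?_
    simp_rw [abs_target]
    rw [Fintype.sum_prod_type]
    simp_rw [← Finset.mul_sum, sum_target]
    simp [mul_comm]

/-- There are two sources of error: at node `k` the coefficients are off by `128 * K * h` against
derivatives of size at most 512; at the other nodes the coefficients are nearly the targets, but the
derivatives are at most `512 * h`. The first source, summed over `d + 1` indices, dominates. -/
lemma abs_interpolant_sub_le {d K : ℕ} (hd : 1 ≤ d) (τ : Fin K → E d) {h : ℝ} (hh : 0 ≤ h)
    (hsmall : K * ((d : ℝ) + 1) * (64 * h) ≤ 1 / 2) {x : Fin K × Option (Fin d) → ℝ}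
    (hx : ∀ p, |x p - target p.2| ≤ 128 * K * h) (n : Fin d → ℕ) (hn : ∑ j, n j ≤ 2)
    (v : E d) (k : Fin K) (hv : ∀ l, l ≠ k → decayProd (v - τ l) ≤ h) :
    |interpolant τ x n v - partialD n (v - τ k)| ≤ 2 ^ 18 * (d * K * h) := by
  have hmain : partialD n (v - τ k) = ∑ p : Fin K × Option (Fin d),
      (if p.1 = k then target p.2 else 0) * partialD (optIdx p.2 + n) (v - τ p.1) := by
    rw [Fintype.sum_prod_type, Finset.sum_eq_single k]
    · simp [target, optIdx_none]
    · intro l _ hl; simp [hl]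
    · simp
  rw [hmain, interpolant, ← Finset.sum_sub_distrib]
  refine (Finset.abs_sum_le_sum_abs _ _).trans ?_
  have hterm : ∀ p : Fin K × Option (Fin d),
      |x p * partialD (optIdx p.2 + n) (v - τ p.1) -
        (if p.1 = k then target p.2 else 0) * partialD (optIdx p.2 + n) (v - τ p.1)| ≤
      (if p.1 = k then 512 * (128 * K * h) else 0) + 512 * h * (target p.2 + 128 * K * h) := by
    intro p
    have hb := abs_partialD_optIdx_le p.2 n hn le_rfl (v - τ p.1)
    have ht := target_nonneg p.2
    rw [← sub_mul, abs_mul]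
    split_ifs with hp
    · have : |partialD (optIdx p.2 + n) (v - τ p.1)| ≤ 512 := by
        refine hb.trans ?_
        norm_num
        linarith [decayProd_le_one (v - τ p.1)]
      have h2 : 0 ≤ 512 * h * (target p.2 + 128 * K * h) := by positivity
      have := mul_le_mul (hx p) this (abs_nonneg _) (by positivity)
      linarith
    · have h1 : |x p - 0| ≤ target p.2 + 128 * K * h := by
        have := abs_add_le (x p - target p.2) (target p.2)
        rw [abs_target] at this
        simp only [sub_add_cancel, sub_zero] at this ⊢
        linarith [hx p]
      have h2 : |partialD (optIdx p.2 + n) (v - τ p.1)| ≤ 512 * h := by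
        refine hb.trans ?_
        norm_num
        exact hv _ hp
      have := mul_le_mul h1 h2 (abs_nonneg _) (by positivity)
      linarith
  refine (Finset.sum_le_sum fun p _ => hterm p).trans ?_
  have h1 : ∑ p : Fin K × Option (Fin d), (if p.1 = k then 512 * (128 * K * h) else 0) =
      (d + 1) * (512 * (128 * K * h)) := by
    rw [Fintype.sum_prod_type, Finset.sum_comm]
    simp
  have h2 : ∑ p : Fin K × Option (Fin d), 512 * h * (target p.2 + 128 * K * h) =
      512 * h * (K * (1 + (d + 1) * (128 * K * h))) := by
    rw [← Finset.mul_sum, Fintype.sum_prod_type]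
    simp_rw [Finset.sum_add_distrib, sum_target]
    simp only [Finset.sum_const, Finset.card_univ, Fintype.card_option, Fintype.card_fin,
      nsmul_eq_mul]
    push_cast
    ring
  rw [Finset.sum_add_distrib, h1, h2]
  have hd1 : (1 : ℝ) ≤ d := by exact_mod_cast hd
  have hK0 : (0 : ℝ) ≤ K * h := by positivity
  nlinarith [mul_le_mul_of_nonneg_left hd1 hK0, mul_le_mul_of_nonneg_left hsmall hK0]

lemma hasDerivAt_interpolant_line {d K : ℕ} (τ : Fin K → E d) (x : Fin K × Option (Fin d) → ℝ)
    (n : Fin d → ℕ) (u w : E d) (s : ℝ) :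
    HasDerivAt (fun s : ℝ => interpolant τ x n (u + s • w))
      (∑ i, w i * interpolant τ x (n + Pi.single i 1) (u + s • w)) s := by
  have h : ∀ p ∈ (Finset.univ : Finset (Fin K × Option (Fin d))), HasDerivAt
      (fun s : ℝ => x p * partialD (optIdx p.2 + n) (u + s • w - τ p.1))
      (x p * ∑ i, w i * partialD (optIdx p.2 + n + Pi.single i 1) (u + s • w - τ p.1)) s := by
    intro p _
    have := (hasDerivAt_partialD_line (optIdx p.2 + n) (u - τ p.1) w s).const_mul (x p)
    simpa only [sub_add_eq_add_sub] using this
  refine (HasDerivAt.fun_sum h).congr_deriv ?_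
  simp only [interpolant, Finset.mul_sum, ← add_assoc]
  rw [Finset.sum_comm]
  exact Finset.sum_congr rfl fun i _ => Finset.sum_congr rfl fun p _ => by ring

/-! ### Near and far bounds for the interpolant at separated nodes. -/

section Certificate

lemma le_sub_of_second_deriv_le {f f' f'' : ℝ → ℝ} {a : ℝ} (hf : ∀ s, HasDerivAt f (f' s) s)
    (hf' : ∀ s, HasDerivAt f' (f'' s) s) (h0 : f' 0 = 0)
    (h : ∀ s ∈ Set.Icc (0:ℝ) 1, f'' s ≤ -a) : f 1 ≤ f 0 - a / 2 := by
  have h1 : ∀ s ∈ Set.Icc (0:ℝ) 1, f' s ≤ -a * s := by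
    have hanti : AntitoneOn (fun s => f' s + a * s) (Set.Icc 0 1) := by
      refine antitoneOn_of_hasDerivWithinAt_nonpos (f' := fun s => f'' s + a) (convex_Icc 0 1)
        (HasDerivAt.continuousOn fun s _ =>
          (hf' s).add ((hasDerivAt_id s).const_mul a)) (fun s _ => ?_) fun s hs => ?_
      · refine (((hf' s).add ((hasDerivAt_id s).const_mul a)).congr_deriv ?_).hasDerivWithinAt
        rw [mul_one]
      · rw [interior_Icc] at hs
        linarith [h s (Set.Ioo_subset_Icc_self hs)]
    intro s hs
    have := hanti (Set.left_mem_Icc.2 zero_le_one) hs hs.1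
    simp only [h0] at this
    linarith
  have hanti : AntitoneOn (fun s => f s + a / 2 * s ^ 2) (Set.Icc 0 1) := by
    have hd : ∀ s, HasDerivAt (fun s => f s + a / 2 * s ^ 2) (f' s + a * s) s := fun s => by
      refine ((hf s).add (((hasDerivAt_id s).pow 2).const_mul (a / 2))).congr_deriv ?_
      simp
      ring
    refine antitoneOn_of_hasDerivWithinAt_nonpos (convex_Icc 0 1)
      (HasDerivAt.continuousOn fun s _ => hd s) (fun s _ => (hd s).hasDerivWithinAt) fun s hs => ?_
    rw [interior_Icc] at hs
    linarith [h1 s (Set.Ioo_subset_Icc_self hs)]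
  have := hanti (Set.left_mem_Icc.2 zero_le_one) (Set.right_mem_Icc.2 zero_le_one) zero_le_one
  simp only at this
  linarith

lemma one_sub_sum_le_prod {ι : Type*} (s : Finset ι) {f : ι → ℝ} (h0 : ∀ i ∈ s, 0 ≤ f i)
    (h1 : ∀ i ∈ s, f i ≤ 1) : 1 - ∑ i ∈ s, f i ≤ ∏ i ∈ s, (1 - f i) := by
  classical
  induction s using Finset.induction_on with
  | empty => simp
  | insert a s ha ih =>
    rw [Finset.sum_insert ha, Finset.prod_insert ha]
    have ih := ih (fun i hi => h0 i (Finset.mem_insert_of_mem hi))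
      fun i hi => h1 i (Finset.mem_insert_of_mem hi)
    have hs := Finset.sum_nonneg fun i hi => h0 i (Finset.mem_insert_of_mem hi)
    have ha0 := h0 a (Finset.mem_insert_self _ _)
    have ha1 := h1 a (Finset.mem_insert_self _ _)
    nlinarith [mul_le_mul_of_nonneg_left ih (sub_nonneg.2 ha1), mul_nonneg ha0 hs]

/-- The radius is of order `1 / d` so that the `d - 1` undifferentiated factors keep a product above
`1 / 2`, and so that the off-diagonal entries, at most `(1 / (32 * d))²`, remain negligible when
summed over all pairs of indices. -/
lemma partialD_single_add_single_le {d : ℕ} (hd : 1 ≤ d) {v : E d} (hv : ‖v‖ ≤ 1 / (2048 * d))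
    (i j : Fin d) (w : E d) :
    w i * (w j * partialD (Pi.single i 1 + Pi.single j 1) v) ≤
      (if i = j then -(1 / 2) * w i ^ 2 else 0) + 2⁻¹ ^ 10 / d * (|w i| * |w j|) := by
  have hd1 : (1 : ℝ) ≤ d := by exact_mod_cast hd
  have hd0 : (0 : ℝ) < d := by linarith
  have hε : (1 : ℝ) / (2048 * d) ≤ 1 / 2048 := by
    apply one_div_le_one_div_of_le <;> linarith
  have hvj : ∀ j, |v j| ≤ 1 / (2048 * d) := fun j => (PiLp.norm_apply_le v j).trans hv
  have hpos : 0 ≤ 2⁻¹ ^ 10 / d * (|w i| * |w j|) := by positivity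
  split_ifs with hij
  · subst hij
    have h2 : sincFour 2 (v i) ≤ -1 := by
      have h := abs_sincFour_sub_le 2 le_rfl (v i)
      rw [sincFour_two_zero, abs_le] at h
      have h3 := hvj i
      linarith [h.2]
    have hprod : 1 / 2 ≤ ∏ j ∈ Finset.univ.erase i, sincFour 0 (v j) := by
      have hle : ∀ j, 1 - 8 * |v j| ≤ sincFour 0 (v j) := fun j => by
        have h := abs_sincFour_sub_le 0 (by norm_num) (v j)
        rw [sincFour_zero_zero, abs_le] at h
        norm_num at h
        linarith [h.1]
      calc (1:ℝ) / 2 ≤ 1 - ∑ j ∈ Finset.univ.erase i, 8 * |v j| := by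
            have : ∑ j ∈ Finset.univ.erase i, 8 * |v j| ≤ ∑ _j : Fin d, 8 * (1 / (2048 * (d : ℝ))) :=
              (Finset.sum_le_sum_of_subset_of_nonneg (Finset.erase_subset _ _)
                fun _ _ _ => by positivity).trans
              (Finset.sum_le_sum fun j _ => mul_le_mul_of_nonneg_left (hvj j) (by norm_num))
            have h3 : ∑ _j : Fin d, 8 * (1 / (2048 * (d:ℝ))) = 1 / 256 := by
              simp; field_simp; norm_num
            linarith
        _ ≤ ∏ j ∈ Finset.univ.erase i, (1 - 8 * |v j|) := by
            refine one_sub_sum_le_prod _ (fun _ _ => by positivity) fun j _ => ?_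
            linarith [hvj j]
        _ ≤ _ := Finset.prod_le_prod (fun j _ => by linarith [hvj j]) fun j _ => hle j
    have hD : partialD (Pi.single i 1 + Pi.single i 1) v =
        sincFour 2 (v i) * ∏ j ∈ Finset.univ.erase i, sincFour 0 (v j) := by
      rw [partialD, ← Finset.mul_prod_erase _ _ (Finset.mem_univ i)]
      congr 1
      · simp
      · refine Finset.prod_congr rfl fun j hj => ?_
        simp [Finset.ne_of_mem_erase hj]
    have hD2 : partialD (Pi.single i 1 + Pi.single i 1) v ≤ -(1 / 2) := by
      rw [hD]; nlinarith
    nlinarith [mul_le_mul_of_nonneg_left hD2 (sq_nonneg (w i))]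
  · have h1 : ∀ j, |sincFour 1 (v j)| ≤ 1 / (32 * d) := fun j => by
      have h := abs_sincFour_sub_le 1 (by norm_num) (v j)
      rw [sincFour_one_zero, sub_zero] at h
      refine h.trans ?_
      calc (8:ℝ) ^ (1 + 1) * |v j| ≤ 8 ^ (1 + 1) * (1 / (2048 * d)) := by gcongr; exact hvj j
        _ = _ := by field_simp; norm_num
    have hD : |partialD (Pi.single i 1 + Pi.single j 1) v| ≤ 1 / (32 * d) * (1 / (32 * d)) := by
      rw [partialD, ← Finset.mul_prod_erase _ _ (Finset.mem_univ i),
        ← Finset.mul_prod_erase _ _ (Finset.mem_erase.2 ⟨Ne.symm hij, Finset.mem_univ j⟩),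
        ← mul_assoc, abs_mul, abs_mul, Finset.abs_prod]
      refine (mul_le_of_le_one_right (by positivity) (Finset.prod_le_one
        (fun _ _ => abs_nonneg _) fun k hk => ?_)).trans ?_
      · have hk1 := Finset.ne_of_mem_erase hk
        have hk2 := Finset.ne_of_mem_erase (Finset.mem_of_mem_erase hk)
        simp only [Pi.add_apply, Pi.single_eq_of_ne hk1, Pi.single_eq_of_ne hk2, add_zero]
        rw [abs_of_nonneg (sincFour_zero_nonneg _)]
        exact sincFour_zero_le_one _
      · simp only [Pi.add_apply, Pi.single_eq_same, Pi.single_eq_of_ne hij,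
          Pi.single_eq_of_ne (Ne.symm hij), add_zero, zero_add]
        exact mul_le_mul (h1 i) (h1 j) (abs_nonneg _) (by positivity)
    have hD2 : |partialD (Pi.single i 1 + Pi.single j 1) v| ≤ 2⁻¹ ^ 10 / d := by
      refine hD.trans ?_
      rw [div_mul_div_comm, div_le_div_iff₀ (by positivity) hd0]
      nlinarith
    rw [zero_add]
    refine (le_abs_self _).trans ?_
    rw [← mul_assoc, abs_mul, abs_mul, mul_comm]
    gcongr

lemma sum_abs_mul_abs_le {d : ℕ} (w : E d) : ∑ i, ∑ j, |w i| * |w j| ≤ d * ‖w‖ ^ 2 := by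
  rw [← Finset.sum_mul_sum, ← sq, EuclideanSpace.norm_sq_eq]
  have := sq_sum_le_card_mul_sum_sq (s := Finset.univ) (f := fun i => |w i|)
  simpa using this

/-- The separation scale, in units of `√d`. -/
noncomputable def sepScale (d K : ℕ) : ℝ := 2 ^ 12 * √K * d

lemma sepScale_ge_one {d K : ℕ} (hd : 1 ≤ d) (hK : 1 ≤ K) : 1 ≤ sepScale d K := by
  have hd1 : (1 : ℝ) ≤ d := by exact_mod_cast hd
  have hK1 : (1 : ℝ) ≤ √K := Real.one_le_sqrt.2 (by exact_mod_cast hK)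
  rw [sepScale]
  nlinarith

lemma sepScale_pow {d K : ℕ} : sepScale d K ^ 4 = 2 ^ 48 * (K ^ 2 * d ^ 4) := by
  have : √(K : ℝ) ^ 4 = K ^ 2 := by
    rw [show 4 = 2 * 2 by norm_num, pow_mul, Real.sq_sqrt K.cast_nonneg]
  rw [sepScale, mul_pow, mul_pow, this]; ring

/-- The factor `d` in `sepScale` is chosen here: its fourth power turns an error of order `d * K *
h` into `1 / d³`, the order of the far-region gain. -/
lemma error_le {d K : ℕ} (hd : 1 ≤ d) (hK : 1 ≤ K) :
    2 ^ 18 * (d * K * (sepScale d K ^ 4)⁻¹) ≤ 2⁻¹ ^ 30 / (d : ℝ) ^ 3 := by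
  have hd1 : (1 : ℝ) ≤ d := by exact_mod_cast hd
  have hK1 : (1 : ℝ) ≤ K := by exact_mod_cast hK
  rw [sepScale_pow, ← div_eq_mul_inv, ← mul_div_assoc, div_le_div_iff₀ (by positivity)
    (by positivity)]
  have : (d : ℝ) ^ 4 * K ≤ d ^ 4 * K ^ 2 := by
    gcongr; nlinarith
  nlinarith

lemma small_le {d K : ℕ} (hd : 1 ≤ d) (hK : 1 ≤ K) :
    K * ((d : ℝ) + 1) * (64 * (sepScale d K ^ 4)⁻¹) ≤ 1 / 2 := by
  have hd1 : (1 : ℝ) ≤ d := by exact_mod_cast hd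
  have hK1 : (1 : ℝ) ≤ K := by exact_mod_cast hK
  rw [sepScale_pow, ← div_eq_mul_inv, ← mul_div_assoc, div_le_div_iff₀ (by positivity)
    (by positivity)]
  have h1 : (K : ℝ) ≤ K ^ 2 := by nlinarith
  have h2 : (d : ℝ) ≤ d ^ 4 := le_self_pow₀ hd1 (by norm_num)
  have h3 : (1 : ℝ) ≤ d ^ 4 := one_le_pow₀ hd1
  have h4 : (K : ℝ) * (d + 1) ≤ K ^ 2 * (d ^ 4 + d ^ 4) := by gcongr
  nlinarith

variable {d K : ℕ} {τ : Fin K → E d} {x : Fin K × Option (Fin d) → ℝ}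

lemma abs_interpolant_sub_le_of_sep (hd : 1 ≤ d) (hK : 1 ≤ K)
    (hx : ∀ p, |x p - target p.2| ≤ 128 * K * (sepScale d K ^ 4)⁻¹)
    (n : Fin d → ℕ) (hn : ∑ j, n j ≤ 2) (v : E d) (k : Fin K)
    (hv : ∀ l, l ≠ k → sepScale d K * √d ≤ ‖v - τ l‖) :
    |interpolant τ x n v - partialD n (v - τ k)| ≤ 2⁻¹ ^ 30 / (d : ℝ) ^ 3 := by
  have h0 : 0 < sepScale d K := by linarith [sepScale_ge_one hd hK]
  exact (abs_interpolant_sub_le hd τ (by positivity) (small_le hd hK) hx n hn v k fun l hl =>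
    decayProd_le_of_le_norm hd _ h0 (hv l hl)).trans (error_le hd hK)

lemma interpolant_bounds_of_sep (hd : 1 ≤ d) (hK : 1 ≤ K)
    (hx : ∀ p, |x p - target p.2| ≤ 128 * K * (sepScale d K ^ 4)⁻¹) (v : E d) (k : Fin K)
    (hv : ∀ l, l ≠ k → sepScale d K * √d ≤ ‖v - τ l‖) :
    -(7 / 8) ≤ interpolant τ x 0 v ∧
      interpolant τ x 0 v ≤ partialD 0 (v - τ k) + 2⁻¹ ^ 30 / (d : ℝ) ^ 3 := by
  have h := abs_le.1 (abs_interpolant_sub_le_of_sep hd hK hx 0 (by simp) v k hv)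
  have hd1 : (1 : ℝ) ≤ d ^ 3 := one_le_pow₀ (by exact_mod_cast hd)
  have h1 : 2⁻¹ ^ 30 / (d : ℝ) ^ 3 ≤ 2⁻¹ ^ 30 := div_le_self (by positivity) hd1
  have h2 : 0 ≤ partialD 0 (v - τ k) := Finset.prod_nonneg fun _ _ => sincFour_zero_nonneg _
  norm_num at h h1 ⊢
  constructor <;> linarith [h.1, h.2]

/-- Compare with the bump at the nearest node; every other node is at least half the separation
away. With `y = 1 / (2048 * d * √d)`, the gain `y² / 48 = 2⁻²² / (48 * d³)` is more than twice the
error `2⁻³⁰ / d³`, which leaves the constant `1 / 96`. -/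
lemma interpolant_far (hd : 1 ≤ d) (hK : 1 ≤ K)
    (hsep : ∀ l k, l ≠ k → 2 * (sepScale d K * √d) ≤ ‖τ l - τ k‖)
    (hx : ∀ p, |x p - target p.2| ≤ 128 * K * (sepScale d K ^ 4)⁻¹) (v : E d)
    (hv : ∀ k, 1 / (2048 * d) < ‖v - τ k‖) :
    -(7 / 8) ≤ interpolant τ x 0 v ∧
      interpolant τ x 0 v ≤ 1 - 1 / 96 * ((1 / 2048) ^ 2 / (d : ℝ) ^ 3) := by
  have : Nonempty (Fin K) := ⟨⟨0, hK⟩⟩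
  have hd1 : (1 : ℝ) ≤ d := by exact_mod_cast hd
  obtain ⟨k, hk⟩ := Finite.exists_min fun k => ‖v - τ k‖
  have hb := interpolant_bounds_of_sep hd hK hx v k fun l hl => by
    have h1 := hsep l k hl
    have h2 : ‖τ l - τ k‖ ≤ ‖v - τ k‖ + ‖v - τ l‖ := by
      rw [show τ l - τ k = (v - τ k) - (v - τ l) by abel]
      exact norm_sub_le _ _
    linarith [hk l]
  refine ⟨hb.1, hb.2.trans ?_⟩
  have hs1 : (1 : ℝ) ≤ √d := Real.one_le_sqrt.2 hd1
  obtain ⟨j, hj⟩ := exists_coord_ge hd (v - τ k) (r := 1 / (2048 * d * √d)) (by positivity) (by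
    refine le_trans (le_of_eq ?_) (hv k).le
    field_simp)
  have hy1 : 1 / (2048 * d * √d) ≤ 1 := by
    rw [div_le_one (by positivity)]
    nlinarith
  have h1 := sincFour_zero_le (by positivity) hy1 hj
  have h2 : partialD 0 (v - τ k) ≤ sincFour 0 ((v - τ k) j) := by
    rw [partialD, ← Finset.mul_prod_erase _ _ (Finset.mem_univ j)]
    exact mul_le_of_le_one_right (sincFour_zero_nonneg _) (Finset.prod_le_one
      (fun _ _ => sincFour_zero_nonneg _) fun _ _ => sincFour_zero_le_one _)
  have h3 : (1 / (2048 * d * √d)) ^ 2 = (1 / 2048) ^ 2 / (d : ℝ) ^ 3 := by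
    rw [div_pow, mul_pow, mul_pow, Real.sq_sqrt d.cast_nonneg]
    field_simp
  rw [h3] at h1
  have h4 : 0 < ((d : ℝ) ^ 3)⁻¹ := by positivity
  simp only [div_eq_mul_inv] at h1 h2 ⊢
  norm_num at h1 h2 ⊢
  linarith

lemma interpolant_near (hd : 1 ≤ d) (hK : 1 ≤ K)
    (hsep : ∀ l k, l ≠ k → 2 * (sepScale d K * √d) ≤ ‖τ l - τ k‖)
    (hint : ∀ l o, interpolant τ x (optIdx o) (τ l) = target o)
    (hx : ∀ p, |x p - target p.2| ≤ 128 * K * (sepScale d K ^ 4)⁻¹) (k : Fin K) (v : E d)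
    (hv : ‖v - τ k‖ ≤ 1 / (2048 * d)) :
    -(7 / 8) ≤ interpolant τ x 0 v ∧ interpolant τ x 0 v ≤ 1 - 1 / 8 * ‖v - τ k‖ ^ 2 := by
  have hd1 : (1 : ℝ) ≤ d := by exact_mod_cast hd
  have hd0 : (0 : ℝ) < d := by linarith
  have hfar : ∀ u, ‖u - τ k‖ ≤ 1 / (2048 * d) → ∀ l, l ≠ k →
      sepScale d K * √d ≤ ‖u - τ l‖ := by
    intro u hu l hl
    have h1 := hsep l k hl
    have h2 : ‖τ l - τ k‖ ≤ ‖u - τ k‖ + ‖u - τ l‖ := by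
      rw [show τ l - τ k = (u - τ k) - (u - τ l) by abel]
      exact norm_sub_le _ _
    have h3 : (1 : ℝ) / (2048 * d) ≤ 1 := by
      rw [div_le_one (by positivity)]; linarith
    have h4 := sepScale_ge_one hd hK
    have hs1 : (1 : ℝ) ≤ √d := Real.one_le_sqrt.2 hd1
    nlinarith
  refine ⟨(interpolant_bounds_of_sep hd hK hx v k (hfar v hv)).1, ?_⟩
  set w := v - τ k with hw
  -- On the segment from `τ k` to `v` the initial slope is 0 by interpolation. The second derivative
  -- is at most `(-1/2 + 2⁻⁹) * ‖w‖²`: Cauchy–Schwarz on the cross terms costs a factor `d`,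
  -- cancelled by the `1 / d` in the entry bounds.
  have key := le_sub_of_second_deriv_le (a := ‖w‖ ^ 2 / 4)
    (f := fun s => interpolant τ x 0 (τ k + s • w))
    (f' := fun s => ∑ i, w i * interpolant τ x (0 + Pi.single i 1) (τ k + s • w))
    (f'' := fun s => ∑ i, w i * ∑ j, w j *
      interpolant τ x (0 + Pi.single i 1 + Pi.single j 1) (τ k + s • w))
    (fun s => hasDerivAt_interpolant_line τ x 0 (τ k) w s)
    (fun s => HasDerivAt.fun_sum fun i _ =>
      (hasDerivAt_interpolant_line τ x _ (τ k) w s).const_mul (w i))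
    (Finset.sum_eq_zero fun i _ => by
      have := hint k (some i)
      rw [optIdx_some] at this
      simp [this, target])
    (fun s hs => by
      have hu : ‖(τ k + s • w) - τ k‖ ≤ 1 / (2048 * d) := by
        rw [add_sub_cancel_left, norm_smul, Real.norm_eq_abs, abs_of_nonneg hs.1]
        exact (mul_le_of_le_one_left (norm_nonneg _) hs.2).trans hv
      have hterm : ∀ i j, w i * (w j *
          interpolant τ x (0 + Pi.single i 1 + Pi.single j 1) (τ k + s • w)) ≤
          (if i = j then -(1 / 2) * w i ^ 2 else 0) + 2⁻¹ ^ 9 / d * (|w i| * |w j|) := by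
        intro i j
        have h1 := partialD_single_add_single_le hd hu i j w
        have h2 := abs_interpolant_sub_le_of_sep hd hK hx (0 + Pi.single i 1 + Pi.single j 1)
          (by simp [Finset.sum_add_distrib]) (τ k + s • w) k (hfar _ hu)
        rw [zero_add] at h2 ⊢
        have h3 : 2⁻¹ ^ 30 / (d : ℝ) ^ 3 ≤ 2⁻¹ ^ 10 / d := by
          refine div_le_div₀ (by positivity) ?_ hd0 (le_self_pow₀ hd1 (by norm_num))
          norm_num
        have h4 := (le_abs_self _).trans ((abs_mul (w i * w j) _).trans_le
          (mul_le_mul_of_nonneg_left (h2.trans h3) (abs_nonneg _)))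
        rw [abs_mul] at h4
        have h5 : (2⁻¹ : ℝ) ^ 9 / d * (|w i| * |w j|) =
          2⁻¹ ^ 10 / d * (|w i| * |w j|) + |w i| * |w j| * (2⁻¹ ^ 10 / d) := by ring
        rw [h5]
        linarith
      simp_rw [Finset.mul_sum]
      refine (Finset.sum_le_sum fun i _ => Finset.sum_le_sum fun j _ => hterm i j).trans ?_
      simp_rw [Finset.sum_add_distrib, ← Finset.mul_sum]
      have h1 : ∑ i : Fin d, ∑ j : Fin d, (if i = j then -(1 / 2) * w i ^ 2 else 0) =
          -(1 / 2) * ‖w‖ ^ 2 := by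
        simp [EuclideanSpace.norm_sq_eq, Finset.mul_sum]
      have h2 : 2⁻¹ ^ 9 / (d : ℝ) * ∑ i, ∑ j, |w i| * |w j| ≤ 2⁻¹ ^ 9 * ‖w‖ ^ 2 := by
        refine (mul_le_mul_of_nonneg_left (sum_abs_mul_abs_le w) (by positivity)).trans_eq ?_
        field_simp
      simp_rw [← Finset.mul_sum] at h2
      rw [h1]
      norm_num at h2 ⊢
      nlinarith [sq_nonneg ‖w‖])
  have h0 := hint k none
  rw [optIdx_none] at h0
  simp only [one_smul, zero_smul, add_zero, h0, target, if_true, hw] at key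
  simp only [add_sub_cancel] at key
  rw [hw]
  linarith

/-- The coefficients at one node have absolute sum at most `1 + (d + 1) * 128 * K * h ≤ 2`, and each
generator is at most 8 times the profile. -/
lemma abs_interpolant_le (hd : 1 ≤ d) (hK : 1 ≤ K)
    (hx : ∀ p, |x p - target p.2| ≤ 128 * K * (sepScale d K ^ 4)⁻¹) (v : E d) :
    |interpolant τ x 0 v| ≤ 16 * ∑ k, decayProd (v - τ k) := by
  rw [interpolant]
  refine (Finset.abs_sum_le_sum_abs _ _).trans ?_
  have hterm : ∀ p : Fin K × Option (Fin d), |x p * partialD (optIdx p.2 + 0) (v - τ p.1)| ≤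
      8 * decayProd (v - τ p.1) * (target p.2 + 128 * K * (sepScale d K ^ 4)⁻¹) := by
    intro p
    have hb := abs_partialD_optIdx_le p.2 0 (k := 0) (by simp) (by norm_num) (v - τ p.1)
    have h1 : |x p| ≤ target p.2 + 128 * K * (sepScale d K ^ 4)⁻¹ := by
      have := abs_add_le (x p - target p.2) (target p.2)
      rw [abs_target] at this
      simp only [sub_add_cancel] at this ⊢
      linarith [hx p]
    rw [abs_mul, mul_comm]
    simp only [add_zero, pow_one] at hb ⊢
    exact mul_le_mul hb h1 (abs_nonneg _) (mul_nonneg (by norm_num) (decayProd_pos _).le)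
  refine (Finset.sum_le_sum fun p _ => hterm p).trans ?_
  rw [Fintype.sum_prod_type, Finset.mul_sum]
  refine Finset.sum_le_sum fun k _ => ?_
  dsimp only
  rw [← Finset.mul_sum, Finset.sum_add_distrib, sum_target]
  simp only [Finset.sum_const, Finset.card_univ, Fintype.card_option, Fintype.card_fin,
    nsmul_eq_mul]
  push_cast
  have := small_le hd hK
  have h2 := (decayProd_pos (v - τ k)).le
  nlinarith [mul_le_mul_of_nonneg_left this h2]

end Certificate

/-! ### Fourier identities for integrable functions. -/

open scoped FourierTransform

section General
variable {V : Type*} [NormedAddCommGroup V] [InnerProductSpace ℝ V] [MeasurableSpace V]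
  [BorelSpace V] [FiniteDimensional ℝ V]

lemma integral_fourier_mul {f g : V → ℂ} (hf : Integrable f) (hg : Integrable g) :
    ∫ ξ, 𝓕 f ξ * g ξ = ∫ x, f x * 𝓕 g x := by
  simpa using! VectorFourier.integral_fourierIntegral_smul_eq_flip (L := innerₗ V)
    Real.continuous_fourierChar continuous_inner hf hg

lemma continuous_fourier {f : V → ℂ} (hf : Integrable f) : Continuous (𝓕 f) :=
  VectorFourier.fourierIntegral_continuous Real.continuous_fourierChar
    (L := innerₗ V) continuous_inner hf

lemma integrable_character_mul {f : V → ℂ} (hf : Integrable f) (ξ : V) (c : ℝ) :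
    Integrable fun x => Complex.exp ((c * inner ℝ x ξ : ℝ) * Complex.I) * f x := by
  refine hf.bdd_mul (c := 1) (Continuous.aestronglyMeasurable (by fun_prop))
    (Filter.Eventually.of_forall fun x => ?_)
  rw [Complex.norm_exp_ofReal_mul_I]

lemma fourier_character_mul (f : V → ℂ) (ξ s : V) :
    𝓕 (fun x => Complex.exp ((-2 * Real.pi * inner ℝ x ξ : ℝ) * Complex.I) * f x) s =
      𝓕 f (ξ + s) := by
  rw [Real.fourier_eq', Real.fourier_eq']
  refine integral_congr_ae (Filter.Eventually.of_forall fun x => ?_)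
  simp only [smul_eq_mul, ← mul_assoc, ← Complex.exp_add, inner_add_right]
  congr 2
  push_cast
  ring

/-- The Fourier transform of the product with an inverse Fourier transform is a convolution. -/
lemma fourier_mul_fourierInv {f ρ : V → ℂ} (hf : Integrable f) (hρ : Integrable ρ) (ξ : V) :
    𝓕 (fun x => f x * 𝓕⁻ ρ x) ξ = ∫ s, 𝓕 f (ξ - s) * ρ s := by
  have h := integral_fourier_mul (integrable_character_mul hf ξ (-2 * Real.pi)) hρ.comp_neg
  simp_rw [fourier_character_mul] at h
  rw [← integral_neg_eq_self] at h
  simp only [neg_neg, ← sub_eq_add_neg] at h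
  rw [h, Real.fourier_eq']
  refine integral_congr_ae (Filter.Eventually.of_forall fun x => ?_)
  simp only [smul_eq_mul, mul_assoc]
  rw [Real.fourierInv_eq_fourier_comp_neg]

end General

/-! ### The band of `sinc⁴` and of its derivative. -/

/-- The tent function, the Fourier transform of `sinc²`. -/
noncomputable def tent (ξ : ℝ) : ℂ := ((Real.pi * max 0 (1 - Real.pi * |ξ|) : ℝ) : ℂ)

lemma continuous_tent : Continuous tent := by unfold tent; fun_prop

lemma tent_eq_zero {ξ : ℝ} (h : 1 ≤ Real.pi * |ξ|) : tent ξ = 0 := by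
  simp [tent, max_eq_left (sub_nonpos.2 h)]

lemma support_tent_subset : Function.support tent ⊆ Set.Ioc (-(1 / Real.pi)) (1 / Real.pi) := by
  intro ξ h
  have : |ξ| < 1 / Real.pi := by
    rw [lt_div_iff₀ Real.pi_pos]
    by_contra hc
    exact h (tent_eq_zero (by linarith))
  exact ⟨(abs_lt.1 this).1, (abs_lt.1 this).2.le⟩

lemma integrable_tent : Integrable tent :=
  continuous_tent.integrable_of_hasCompactSupport
    (HasCompactSupport.of_support_subset_isCompact (isCompact_Icc (a := -(1 / Real.pi))
      (b := 1 / Real.pi)) (support_tent_subset.trans Set.Ioc_subset_Icc_self))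

lemma integral_tent_side {a : ℂ} (ha : a ≠ 0) :
    ∫ ξ in (0:ℝ)..(1 / Real.pi), (1 - Real.pi * ξ : ℂ) * Complex.exp (a * ξ) =
      Real.pi * Complex.exp (a / Real.pi) / a ^ 2 - 1 / a - Real.pi / a ^ 2 := by
  have hd : ∀ ξ : ℝ, HasDerivAt (fun ξ : ℝ => (1 - Real.pi * ξ : ℂ) * Complex.exp (a * ξ) / a +
      Real.pi * Complex.exp (a * ξ) / a ^ 2) ((1 - Real.pi * ξ : ℂ) * Complex.exp (a * ξ)) ξ := by
    intro ξ
    have h0 : HasDerivAt (fun ξ : ℝ => (ξ : ℂ)) 1 ξ := Complex.ofRealCLM.hasDerivAt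
    have h1 := (h0.const_mul a).cexp
    have h2 := (h0.const_mul (Real.pi : ℂ)).const_sub 1
    refine (((h2.mul h1).div_const a).add ((h1.const_mul (Real.pi : ℂ)).div_const
      (a ^ 2))).congr_deriv ?_
    field_simp
    ring
  rw [intervalIntegral.integral_eq_sub_of_hasDerivAt (fun ξ _ => hd ξ)
    (Continuous.intervalIntegrable (by fun_prop) _ _)]
  have hpi : (Real.pi : ℂ) ≠ 0 := Complex.ofReal_ne_zero.2 Real.pi_ne_zero
  push_cast
  rw [mul_one_div, mul_one_div, div_self hpi]
  simp
  ring

/-- Folding the tent at 0 gives one-sided integrals with exponents `a` and `-a`. Their `1 / a` terms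
cancel and the rest combines to `-4 * sin² x` over `a² = -4π²x²`. The excluded point `x = 0` is
null, so an almost everywhere identity is enough afterwards. -/
lemma fourierInv_tent_of_ne_zero {x : ℝ} (hx : x ≠ 0) :
    𝓕⁻ tent x = ((Real.sinc x ^ 2 : ℝ) : ℂ) := by
  have hpi : (Real.pi : ℂ) ≠ 0 := Complex.ofReal_ne_zero.2 Real.pi_ne_zero
  have hx' : (x : ℂ) ≠ 0 := Complex.ofReal_ne_zero.2 hx
  set a : ℂ := 2 * Real.pi * x * Complex.I with ha
  have ha0 : a ≠ 0 := by simp [ha, hx]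
  have h1 : 𝓕⁻ tent x = ∫ ξ in (-(1 / Real.pi))..(1 / Real.pi), Complex.exp (a * ξ) * tent ξ := by
    rw [Real.fourierInv_eq', intervalIntegral.integral_eq_integral_of_support_subset]
    · refine integral_congr_ae (Filter.Eventually.of_forall fun ξ => ?_)
      simp only [smul_eq_mul, ha]
      congr 2
      simp
      ring
    · exact fun ξ h => support_tent_subset (right_ne_zero_of_mul h)
  have hc : Continuous fun ξ : ℝ => Complex.exp (a * ξ) * tent ξ := by
    have := continuous_tent
    fun_prop
  have hright : ∫ ξ in (0:ℝ)..(1 / Real.pi), Complex.exp (a * ξ) * tent ξ =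
      Real.pi * ∫ ξ in (0:ℝ)..(1 / Real.pi), (1 - Real.pi * ξ : ℂ) * Complex.exp (a * ξ) := by
    rw [← intervalIntegral.integral_const_mul]
    refine intervalIntegral.integral_congr fun ξ hξ => ?_
    rw [Set.uIcc_of_le (by positivity)] at hξ
    have : Real.pi * ξ ≤ 1 := by
      have := (le_div_iff₀ Real.pi_pos).1 hξ.2
      linarith
    simp only [tent, abs_of_nonneg hξ.1, max_eq_right (sub_nonneg.2 this)]
    push_cast
    ring
  have hleft : ∫ ξ in (-(1 / Real.pi))..0, Complex.exp (a * ξ) * tent ξ =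
      Real.pi * ∫ ξ in (0:ℝ)..(1 / Real.pi), (1 - Real.pi * ξ : ℂ) * Complex.exp (-a * ξ) := by
    have h := intervalIntegral.integral_comp_neg (a := 0) (b := 1 / Real.pi)
      (fun ξ : ℝ => Complex.exp (a * ξ) * tent ξ)
    rw [neg_zero] at h
    rw [← h, ← intervalIntegral.integral_const_mul]
    refine intervalIntegral.integral_congr fun ξ hξ => ?_
    rw [Set.uIcc_of_le (by positivity)] at hξ
    have : Real.pi * ξ ≤ 1 := by
      have := (le_div_iff₀ Real.pi_pos).1 hξ.2
      linarith
    simp only [tent, abs_neg, abs_of_nonneg hξ.1, max_eq_right (sub_nonneg.2 this)]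
    push_cast
    rw [mul_neg, neg_mul]
    ring
  rw [h1, ← intervalIntegral.integral_add_adjacent_intervals (b := 0)
    (hc.intervalIntegrable _ _) (hc.intervalIntegrable _ _), hright, hleft,
    integral_tent_side ha0, integral_tent_side (neg_ne_zero.2 ha0), Real.sinc_of_ne_zero hx]
  have e1 : a / Real.pi = 2 * x * Complex.I := by rw [ha]; field_simp
  have e2 : -a / Real.pi = -(2 * x) * Complex.I := by rw [ha]; field_simp
  have e3 : Complex.exp (2 * x * Complex.I) + Complex.exp (-(2 * x) * Complex.I) =
      2 - 4 * Complex.sin x ^ 2 := by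
    rw [← Complex.two_cos, Complex.cos_two_mul, Complex.cos_sq']
    ring
  have e4 : a ^ 2 = -4 * Real.pi ^ 2 * x ^ 2 := by
    rw [ha, mul_pow, Complex.I_sq]; ring
  rw [e1, e2, neg_sq, e4]
  push_cast
  rw [div_neg]
  have e5 : Complex.exp (-(2 * x) * Complex.I) =
      2 - 4 * Complex.sin x ^ 2 - Complex.exp (2 * x * Complex.I) := by rw [← e3]; ring
  rw [e5]
  field_simp
  ring

lemma abs_sinc_sq_le (x : ℝ) : Real.sinc x ^ 2 ≤ 2 * (1 + x ^ 2)⁻¹ := by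
  rw [← sincDeriv_zero_left, ← div_eq_mul_inv, le_div_iff₀ (by positivity)]
  have h1 := abs_sincDeriv_le_one 0 x
  have h2 := abs_mul_sincDeriv_le 0 x
  have h3 : sincDeriv 0 x ^ 2 ≤ 1 := by rwa [sq_le_one_iff_abs_le_one]
  have h4 : (x * sincDeriv 0 x) ^ 2 ≤ 1 := by
    rw [sq_le_one_iff_abs_le_one, abs_mul]; simpa using h2
  nlinarith

lemma integrable_sinc_sq : Integrable fun x : ℝ => ((Real.sinc x ^ 2 : ℝ) : ℂ) := by
  refine Integrable.ofReal ?_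
  refine (integrable_inv_one_add_sq.const_mul 2).mono'
    (contDiff_sinc.continuous.pow 2).aestronglyMeasurable
    (Filter.Eventually.of_forall fun x => ?_)
  rw [Real.norm_eq_abs, abs_of_nonneg (sq_nonneg _)]
  exact abs_sinc_sq_le x

lemma fourierInv_tent_ae :
    𝓕⁻ tent =ᵐ[volume] fun x : ℝ => ((Real.sinc x ^ 2 : ℝ) : ℂ) := by
  filter_upwards [compl_mem_ae_iff.2 (measure_singleton (μ := volume) (0:ℝ))] with x hx
  exact fourierInv_tent_of_ne_zero hx

lemma fourier_sinc_sq : 𝓕 (fun x : ℝ => ((Real.sinc x ^ 2 : ℝ) : ℂ)) = tent := by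
  funext ξ
  rw [← Real.fourier_congr_ae fourierInv_tent_ae, Continuous.fourier_fourierInv_eq continuous_tent
    integrable_tent]
  have h : Integrable (𝓕⁻ tent) := integrable_sinc_sq.congr fourierInv_tent_ae.symm
  refine h.comp_neg.congr (Filter.Eventually.of_forall fun x => ?_)
  simp [Real.fourierInv_eq_fourier_neg]

lemma decay_le_inv (x : ℝ) : decay x ≤ 2 * (1 + x ^ 2)⁻¹ := by
  rw [decay, ← div_eq_mul_inv, inv_eq_one_div, div_le_div_iff₀
    (pow_pos (max_one_abs_pos x) 4) (by positivity)]
  have h1 : 1 ≤ max 1 |x| := le_max_left _ _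
  have h2 : x ^ 2 ≤ (max 1 |x|) ^ 2 := by rw [← sq_abs]; gcongr; exact le_max_right _ _
  nlinarith [pow_le_pow_left₀ zero_le_one h1 2]

lemma continuous_decay : Continuous decay := by
  unfold decay
  exact Continuous.inv₀ (by fun_prop) fun x => (pow_pos (max_one_abs_pos x) 4).ne'

lemma integrable_decay : Integrable decay := by
  refine (integrable_inv_one_add_sq.const_mul 2).mono' continuous_decay.aestronglyMeasurable
    (Filter.Eventually.of_forall fun x => ?_)
  rw [Real.norm_eq_abs, abs_of_pos (decay_pos x)]
  exact decay_le_inv x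

lemma integral_decay_le : ∫ x, decay x ≤ 2 * Real.pi := by
  refine (integral_mono integrable_decay (integrable_inv_one_add_sq.const_mul 2)
    decay_le_inv).trans_eq ?_
  rw [integral_const_mul, integral_univ_inv_one_add_sq]

lemma continuous_sincFour (n : ℕ) : Continuous (sincFour n) :=
  continuous_iff_continuousAt.2 fun x => (hasDerivAt_sincFour n x).continuousAt

lemma integrable_sincFour (n : ℕ) (hn : n ≤ 3) : Integrable (sincFour n) :=
  (integrable_decay.const_mul (8 ^ n)).mono' (continuous_sincFour n).aestronglyMeasurable
    (Filter.Eventually.of_forall fun x => abs_sincFour_le n hn x)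

/-- The transform of `sinc² * sinc²` is the tent convolved with itself, and each tent lives on `π *
|ξ| < 1`. -/
lemma fourier_sincFour_zero {ξ : ℝ} (h : 4 < 2 * Real.pi * |ξ|) :
    𝓕 (fun x : ℝ => (sincFour 0 x : ℂ)) ξ = 0 := by
  have h1 : (fun x : ℝ => (sincFour 0 x : ℂ)) =ᵐ[volume]
      fun x => ((Real.sinc x ^ 2 : ℝ) : ℂ) * 𝓕⁻ tent x := by
    filter_upwards [fourierInv_tent_ae] with x hx
    rw [hx, sincFour_zero]
    push_cast
    ring
  rw [Real.fourier_congr_ae h1, fourier_mul_fourierInv integrable_sinc_sq integrable_tent,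
    fourier_sinc_sq]
  refine integral_eq_zero_of_ae (Filter.Eventually.of_forall fun s => ?_)
  by_contra hc
  have h2 : Real.pi * |s| < 1 := by
    by_contra hs
    exact hc (by simp [tent_eq_zero (not_lt.1 hs)])
  have h3 : Real.pi * |ξ - s| < 1 := by
    by_contra hs
    exact hc (by simp [tent_eq_zero (not_lt.1 hs)])
  have h4 : |ξ| ≤ |ξ - s| + |s| := by
    simpa using abs_add_le (ξ - s) s
  nlinarith [Real.pi_pos]

lemma fourier_sincFour {n : ℕ} (hn : n ≤ 1) {ξ : ℝ} (h : 4 < 2 * Real.pi * |ξ|) :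
    𝓕 (fun x : ℝ => (sincFour n x : ℂ)) ξ = 0 := by
  interval_cases n
  · exact fourier_sincFour_zero h
  · have hd : ∀ x : ℝ, HasDerivAt (fun x : ℝ => (sincFour 0 x : ℂ)) (sincFour 1 x : ℂ) x :=
      fun x => (hasDerivAt_sincFour 0 x).ofReal_comp
    have hderiv : deriv (fun x : ℝ => (sincFour 0 x : ℂ)) = fun x : ℝ => (sincFour 1 x : ℂ) :=
      funext fun x => (hd x).deriv
    have := Real.fourier_deriv (integrable_sincFour 0 (by norm_num)).ofReal
      (fun x => (hd x).differentiableAt)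
      (by rw [hderiv]; exact (integrable_sincFour 1 (by norm_num)).ofReal)
    rw [hderiv] at this
    rw [this]
    simp only [fourier_sincFour_zero h, smul_zero]

/-! ### Band-limited functions on `ℝ^d`. -/

section Product
variable {d : ℕ}

lemma integral_euclidean_prod {𝕜 : Type*} [RCLike 𝕜] (g : Fin d → ℝ → 𝕜) :
    ∫ v : E d, ∏ j, g j (v j) = ∏ j, ∫ x, g j x := by
  rw [← integral_fintype_prod_volume_eq_prod]
  exact (EuclideanSpace.volume_preserving_symm_measurableEquiv_toLp (Fin d)).integral_comp'
    (fun y : Fin d → ℝ => ∏ j, g j (y j))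

lemma integrable_euclidean_prod {𝕜 : Type*} [RCLike 𝕜] {g : Fin d → ℝ → 𝕜}
    (hg : ∀ j, Integrable (g j)) : Integrable fun v : E d => ∏ j, g j (v j) :=
  ((EuclideanSpace.volume_preserving_symm_measurableEquiv_toLp (Fin d)).integrable_comp_emb
    (MeasurableEquiv.measurableEmbedding _)).2 (Integrable.fintype_prod hg)

lemma fourier_euclidean_prod (g : Fin d → ℝ → ℂ) (ξ : E d) :
    𝓕 (fun v : E d => ∏ j, g j (v j)) ξ = ∏ j, 𝓕 (g j) (ξ j) := by
  simp_rw [Real.fourier_eq']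
  rw [← integral_euclidean_prod]
  refine integral_congr_ae (Filter.Eventually.of_forall fun v => ?_)
  simp only [smul_eq_mul, PiLp.inner_apply]
  rw [Finset.prod_mul_distrib, ← Complex.exp_sum, ← Finset.sum_mul, ← Complex.ofReal_sum,
    ← Finset.mul_sum]

/-- A continuous integrable function whose Fourier transform vanishes outside a cube
(in angular frequencies). -/
structure IsBandLimited (f : E d → ℂ) (R : ℝ) : Prop where
  continuous : Continuous f
  integrable : Integrable f
  fourier_eq_zero : ∀ ξ : E d, (∃ j, R < 2 * Real.pi * |ξ j|) → 𝓕 f ξ = 0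

lemma isBandLimited_partialD (o : Option (Fin d)) :
    IsBandLimited (fun v : E d => (partialD (optIdx o) v : ℂ)) 4 := by
  have ho : ∀ j, optIdx o j ≤ 1 := fun j =>
    (Finset.single_le_sum (fun i _ => Nat.zero_le _) (Finset.mem_univ j)).trans (sum_optIdx_le o)
  have h : (fun v : E d => (partialD (optIdx o) v : ℂ)) =
      fun v => ∏ j, (sincFour (optIdx o j) (v j) : ℂ) := by
    funext v; rw [partialD]; push_cast; rfl
  refine ⟨Complex.continuous_ofReal.comp (continuous_partialD _), ?_, fun ξ ⟨j, hj⟩ => ?_⟩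
  · rw [h]
    exact integrable_euclidean_prod (g := fun j x => (sincFour (optIdx o j) x : ℂ)) fun j =>
      (integrable_sincFour _ ((ho j).trans (by norm_num))).ofReal
  · rw [h, fourier_euclidean_prod (fun j x => (sincFour (optIdx o j) x : ℂ))]
    exact Finset.prod_eq_zero (Finset.mem_univ j) (fourier_sincFour (ho j) hj)

namespace IsBandLimited
variable {f g : E d → ℂ} {R S : ℝ}

lemma comp_sub (h : IsBandLimited f R) (t : E d) : IsBandLimited (fun v => f (v - t)) R := by
  refine ⟨h.continuous.comp (continuous_id.sub continuous_const), h.integrable.comp_sub_right t,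
    fun ξ hξ => ?_⟩
  have h0 := h.fourier_eq_zero ξ hξ
  rw [Real.fourier_eq'] at h0 ⊢
  rw [← integral_add_right_eq_self _ t]
  have : ∀ v : E d, Complex.exp (((-2 * Real.pi * inner ℝ (v + t) ξ : ℝ) : ℂ) * Complex.I) •
      f (v + t - t) = Complex.exp (((-2 * Real.pi * inner ℝ t ξ : ℝ) : ℂ) * Complex.I) *
      (Complex.exp (((-2 * Real.pi * inner ℝ v ξ : ℝ) : ℂ) * Complex.I) • f v) := by
    intro v
    rw [add_sub_cancel_right, inner_add_left, smul_eq_mul, smul_eq_mul, ← mul_assoc,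
      ← Complex.exp_add]
    congr 2
    push_cast
    ring
  simp_rw [this]
  rw [integral_const_mul, h0, mul_zero]

lemma const_mul (h : IsBandLimited f R) (a : ℂ) : IsBandLimited (fun v => a * f v) R := by
  refine ⟨continuous_const.mul h.continuous, h.integrable.const_mul a, fun ξ hξ => ?_⟩
  have h0 := h.fourier_eq_zero ξ hξ
  rw [Real.fourier_eq'] at h0 ⊢
  simp only [smul_eq_mul, mul_left_comm _ a] at h0 ⊢
  rw [integral_const_mul, h0, mul_zero]

lemma sum {ι : Type*} (s : Finset ι) {F : ι → E d → ℂ} (h : ∀ i ∈ s, IsBandLimited (F i) R) :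
    IsBandLimited (fun v => ∑ i ∈ s, F i v) R := by
  refine ⟨continuous_finsetSum s fun i hi => (h i hi).continuous,
    integrable_finsetSum s fun i hi => (h i hi).integrable, fun ξ hξ => ?_⟩
  rw [Real.fourier_eq']
  simp_rw [Finset.smul_sum]
  rw [integral_finsetSum]
  · refine Finset.sum_eq_zero fun i hi => ?_
    rw [← Real.fourier_eq']
    exact (h i hi).fourier_eq_zero ξ hξ
  · intro i hi
    have := integrable_character_mul (h i hi).integrable ξ (-2 * Real.pi)
    simpa using this

lemma support_fourier_subset (h : IsBandLimited f R) :
    Function.support (𝓕 f) ⊆ {ξ | ∀ j, 2 * Real.pi * |ξ j| ≤ R} := by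
  intro ξ hξ j
  by_contra hc
  exact hξ (h.fourier_eq_zero ξ ⟨j, not_le.1 hc⟩)

lemma _root_.StrongCertificate.isCompact_band (R : ℝ) :
    IsCompact {ξ : E d | ∀ j, 2 * Real.pi * |ξ j| ≤ R} := by
  refine Metric.isCompact_of_isClosed_isBounded ?_ ?_
  · simp only [Set.ofPred_forall]
    exact isClosed_iInter fun j => isClosed_le (by fun_prop) continuous_const
  · refine (Metric.isBounded_closedBall (x := (0 : E d)) (r := √(d * R ^ 2))).subset
      fun ξ hξ => ?_
    rw [mem_closedBall_zero_iff, EuclideanSpace.norm_eq]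
    refine Real.sqrt_le_sqrt ?_
    calc ∑ i, ‖ξ i‖ ^ 2 ≤ ∑ _i : Fin d, R ^ 2 := Finset.sum_le_sum fun i _ => by
          have h1 := hξ i
          have h2 : ‖ξ i‖ ≤ R := by
            rw [Real.norm_eq_abs]
            nlinarith [Real.pi_gt_three, abs_nonneg (ξ i)]
          gcongr
      _ = _ := by simp

lemma integrable_fourier (h : IsBandLimited f R) : Integrable (𝓕 f) :=
  (continuous_fourier h.integrable).integrable_of_hasCompactSupport
    (HasCompactSupport.of_support_subset_isCompact (isCompact_band R) h.support_fourier_subset)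

lemma fourierInv_fourier (h : IsBandLimited f R) : 𝓕⁻ (𝓕 f) = f :=
  h.continuous.fourierInv_fourier_eq h.integrable h.integrable_fourier

/-- Writing `g` as the inverse transform of its integrable spectrum makes the transform of the
product a convolution, whose bands add. -/
lemma mul (hf : IsBandLimited f R) (hg : IsBandLimited g S) {M : ℝ} (hM : ∀ v, ‖g v‖ ≤ M) :
    IsBandLimited (fun v => f v * g v) (R + S) := by
  refine ⟨hf.continuous.mul hg.continuous,
    hf.integrable.mul_bdd (c := M) hg.continuous.aestronglyMeasurable
    (Filter.Eventually.of_forall hM), fun ξ ⟨j, hj⟩ => ?_⟩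
  have h1 : (fun v => f v * g v) = fun v => f v * 𝓕⁻ (𝓕 g) v := by rw [hg.fourierInv_fourier]
  rw [h1, fourier_mul_fourierInv hf.integrable hg.integrable_fourier]
  refine integral_eq_zero_of_ae (Filter.Eventually.of_forall fun s => ?_)
  by_cases hs : S < 2 * Real.pi * |s j|
  · simp [hg.fourier_eq_zero s ⟨j, hs⟩]
  · have : R < 2 * Real.pi * |(ξ - s) j| := by
      have h4 : |ξ j| ≤ |(ξ - s) j| + |s j| := by
        simpa using abs_add_le (ξ j - s j) (s j)
      nlinarith [Real.pi_pos]
    simp [hf.fourier_eq_zero (ξ - s) ⟨j, this⟩]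

lemma comp_smul (h : IsBandLimited f R) {m : ℝ} (hm : 0 < m) :
    IsBandLimited (fun v => f (m • v)) (R * m) := by
  refine ⟨h.continuous.comp (continuous_const_smul m),
    h.integrable.comp_smul hm.ne', fun ξ ⟨j, hj⟩ => ?_⟩
  have h0 := h.fourier_eq_zero (m⁻¹ • ξ) ⟨j, by
    rw [PiLp.smul_apply, smul_eq_mul, abs_mul, abs_of_pos (inv_pos.2 hm)]
    field_simp
    linarith⟩
  rw [Real.fourier_eq'] at h0 ⊢
  have := Measure.integral_comp_smul volume (fun v : E d =>
    Complex.exp (((-2 * Real.pi * inner ℝ v (m⁻¹ • ξ) : ℝ) : ℂ) * Complex.I) • f v) m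
  rw [h0, smul_zero] at this
  rw [← this]
  refine integral_congr_ae (Filter.Eventually.of_forall fun v => ?_)
  simp only [inner_smul_left, inner_smul_right, conj_trivial, inv_mul_cancel_left₀ hm.ne']

end IsBandLimited

lemma fourierT_eq (f : E d → ℝ) (ω : E d) :
    fourierT f ω = 𝓕 (fun x => (f x : ℂ)) ((2 * Real.pi)⁻¹ • ω) := by
  rw [fourierT, Real.fourier_eq']
  refine integral_congr_ae (Filter.Eventually.of_forall fun x => ?_)
  simp only [smul_eq_mul, inner_smul_right]
  congr 2
  have hpi : (Real.pi : ℂ) ≠ 0 := Complex.ofReal_ne_zero.2 Real.pi_ne_zero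
  push_cast
  field_simp

lemma fourier_eq_fourierT (f : E d → ℝ) (ξ : E d) :
    𝓕 (fun x => (f x : ℂ)) ξ = fourierT f ((2 * Real.pi) • ξ) := by
  rw [fourierT_eq, smul_smul, inv_mul_cancel₀ (by positivity), one_smul]

lemma IsBandLimited.tsupport_fourierT_subset {f : E d → ℝ} {R : ℝ}
    (h : IsBandLimited (fun v => (f v : ℂ)) R) : tsupport (fourierT f) ⊆ cube d R := by
  refine closure_minimal (fun ω hω j => ?_) ?_
  · by_contra hc
    refine hω ?_
    rw [fourierT_eq]
    refine h.fourier_eq_zero _ ⟨j, ?_⟩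
    rw [PiLp.smul_apply, smul_eq_mul, abs_mul, abs_of_pos (by positivity),
      mul_inv_cancel_left₀ (by positivity)]
    exact not_le.1 hc
  · simp only [cube, Set.ofPred_forall]
    exact isClosed_iInter fun j => isClosed_le (by fun_prop) continuous_const

end Product

/-! ### Deconvolution inside the reproducing kernel Hilbert space. -/

section Deconvolution

/-- A function dominated by the kernel belongs to the reproducing kernel Hilbert space. -/
lemma exists_coe_eq_of_bound {X H : Type*} [NormedAddCommGroup H] [InnerProductSpace ℝ H]
    [CompleteSpace H] [RKHS ℝ H X ℝ] (c : X → ℝ) (M : ℝ)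
    (h : ∀ z : X →₀ ℝ, |Finsupp.linearCombination ℝ c z| ≤
      M * ‖Finsupp.linearCombination ℝ (fun x => RKHS.kerFun H x (1 : ℝ)) z‖) :
    ∃ f : H, ∀ x, f x = c x := by
  set T := Finsupp.linearCombination ℝ (fun x => RKHS.kerFun H x (1 : ℝ)) with hT
  set L := Finsupp.linearCombination ℝ c with hL
  -- A linear choice of preimages defines the functional on the span of the kernel functions. The
  -- bound shows that `L` vanishes wherever `T` does, so the choice is immaterial, and it gives
  -- continuity.
  obtain ⟨g, hg⟩ := T.rangeRestrict.exists_rightInverse_of_surjective T.range_rangeRestrict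
  have hTg : ∀ y : LinearMap.range T, T (g y) = y := fun y =>
    congrArg Subtype.val (LinearMap.congr_fun hg y)
  have hLg : ∀ z, L (g (T.rangeRestrict z)) = L z := fun z => by
    have h1 := h (g (T.rangeRestrict z) - z)
    rw [map_sub, map_sub, hTg, show ((T.rangeRestrict z : LinearMap.range T) : H) = T z from rfl,
      sub_self, norm_zero, mul_zero] at h1
    exact sub_eq_zero.1 (abs_eq_zero.1 (le_antisymm h1 (abs_nonneg _)))
  let L' : StrongDual ℝ (LinearMap.range T) := (L ∘ₗ g).mkContinuous M fun y => by
    have := h (g y)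
    rwa [hTg] at this
  obtain ⟨F, hF, -⟩ := exists_extension_norm_eq (LinearMap.range T) L'
  refine ⟨(InnerProductSpace.toDual ℝ H).symm F, fun x => ?_⟩
  have h1 := RKHS.kerFun_inner (H := H) x (1 : ℝ) ((InnerProductSpace.toDual ℝ H).symm F)
  rw [real_inner_comm, InnerProductSpace.toDual_symm_apply] at h1
  have h2 : T (Finsupp.single x 1) = RKHS.kerFun H x (1 : ℝ) := by simp [hT]
  have h3 : L (Finsupp.single x 1) = c x := by simp [hL]
  have h4 := hF (T.rangeRestrict (Finsupp.single x 1))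
  rw [show ((T.rangeRestrict (Finsupp.single x 1) : LinearMap.range T) : H) = _ from h2, h1] at h4
  have h5 : L' (T.rangeRestrict (Finsupp.single x 1)) = c x := by
    rw [← h3, ← hLg]; rfl
  rw [h5] at h4
  simpa using h4

variable {d : ℕ}

lemma invFourierT_eq (l : E d → ℝ) (x : E d) :
    invFourierT l x = ∫ ξ : E d, Complex.exp (((2 * Real.pi * inner ℝ x ξ : ℝ) : ℂ) * Complex.I) *
      (l ((2 * Real.pi) • ξ) : ℂ) := by
  have h := Measure.integral_comp_smul volume (fun ω : E d =>
    Complex.exp (Complex.I * ((inner ℝ x ω : ℝ) : ℂ)) * (l ω : ℂ)) (2 * Real.pi)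
  rw [invFourierT]
  have hfin : Module.finrank ℝ (E d) = d := by simp
  rw [hfin, abs_of_pos (by positivity), Complex.real_smul] at h
  push_cast at h
  rw [← h]
  refine integral_congr_ae (Filter.Eventually.of_forall fun ξ => ?_)
  simp only [inner_smul_right]
  congr 2
  push_cast
  ring

/-- The exponential sum with nodes and coefficients given by `z`. -/
noncomputable def expSum (z : E d →₀ ℝ) (ξ : E d) : ℂ :=
  z.sum fun x a => (a : ℂ) * Complex.exp (((2 * Real.pi * inner ℝ x ξ : ℝ) : ℂ) * Complex.I)

lemma continuous_expSum (z : E d →₀ ℝ) : Continuous (expSum z) := by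
  unfold expSum Finsupp.sum
  fun_prop

lemma norm_expSum_le (z : E d →₀ ℝ) (ξ : E d) : ‖expSum z ξ‖ ≤ z.sum fun _ a => |a| := by
  refine (norm_sum_le _ _).trans (Finset.sum_le_sum fun x _ => ?_)
  simp only [norm_mul, Complex.norm_exp_ofReal_mul_I, mul_one, Complex.norm_real,
    Real.norm_eq_abs, le_refl]

lemma normSq_expSum (z : E d →₀ ℝ) (ξ : E d) : ((‖expSum z ξ‖ ^ 2 : ℝ) : ℂ) =
    z.sum fun x a => z.sum fun y b => ((a * b : ℝ) : ℂ) *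
      Complex.exp (((2 * Real.pi * inner ℝ (x - y) ξ : ℝ) : ℂ) * Complex.I) := by
  have h : ((‖expSum z ξ‖ ^ 2 : ℝ) : ℂ) = expSum z ξ * starRingEnd ℂ (expSum z ξ) := by
    rw [Complex.mul_conj, Complex.normSq_eq_norm_sq]
  rw [h, expSum, Finsupp.sum, map_sum, Finset.sum_mul_sum]
  refine Finset.sum_congr rfl fun x _ => Finset.sum_congr rfl fun y _ => ?_
  dsimp only
  rw [map_mul, Complex.conj_ofReal, ← Complex.exp_conj, map_mul, Complex.conj_ofReal,
    Complex.conj_I, mul_mul_mul_comm, ← Complex.exp_add, inner_sub_left]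
  push_cast
  congr 2
  ring

/-- The reproducing property gives `∑ z x * z y * lam (x - y)`; inserting the spectral
representation of `lam` turns this into a weighted `L²` norm of the exponential sum. -/
lemma norm_sq_linearCombination_kerFun {lam l : E d → ℝ} (hl : IsSpectralDensity lam l)
    {H : Type} [NormedAddCommGroup H] [InnerProductSpace ℝ H] [CompleteSpace H]
    [RKHS ℝ H (E d) ℝ] (hH : HasReproducingKernel lam H) (z : E d →₀ ℝ) :
    ‖Finsupp.linearCombination ℝ (fun x => RKHS.kerFun H x (1 : ℝ)) z‖ ^ 2 =
      ∫ ξ : E d, ‖expSum z ξ‖ ^ 2 * l ((2 * Real.pi) • ξ) := by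
  have hint : Integrable fun ξ : E d => (l ((2 * Real.pi) • ξ) : ℂ) :=
    (hl.integrable.comp_smul (by positivity)).ofReal
  have hterm : ∀ x : E d, Integrable fun ξ : E d =>
      Complex.exp (((2 * Real.pi * inner ℝ x ξ : ℝ) : ℂ) * Complex.I) *
        (l ((2 * Real.pi) • ξ) : ℂ) := fun x => by
    have := integrable_character_mul hint x (2 * Real.pi)
    simpa only [real_inner_comm] using this
  rw [← Complex.ofReal_inj, ← integral_complex_ofReal]
  have h1 : ∀ ξ : E d, ((‖expSum z ξ‖ ^ 2 * l ((2 * Real.pi) • ξ) : ℝ) : ℂ) =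
      ∑ x ∈ z.support, ∑ y ∈ z.support, ((z x * z y : ℝ) : ℂ) *
        (Complex.exp (((2 * Real.pi * inner ℝ (x - y) ξ : ℝ) : ℂ) * Complex.I) *
        (l ((2 * Real.pi) • ξ) : ℂ)) := by
    intro ξ
    rw [Complex.ofReal_mul, normSq_expSum, Finsupp.sum, Finset.sum_mul]
    refine Finset.sum_congr rfl fun x _ => ?_
    rw [Finsupp.sum, Finset.sum_mul]
    exact Finset.sum_congr rfl fun y _ => mul_assoc _ _ _
  simp_rw [h1]
  rw [integral_finsetSum _ fun x _ => integrable_finsetSum _ fun y _ => (hterm _).const_mul _]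
  have h2 : ∀ x ∈ z.support, ∫ ξ : E d, ∑ y ∈ z.support, ((z x * z y : ℝ) : ℂ) *
        (Complex.exp (((2 * Real.pi * inner ℝ (x - y) ξ : ℝ) : ℂ) * Complex.I) *
        (l ((2 * Real.pi) • ξ) : ℂ)) =
      ∑ y ∈ z.support, ((z x * z y : ℝ) : ℂ) * (lam (x - y) : ℂ) := by
    intro x _
    rw [integral_finsetSum _ fun y _ => (hterm _).const_mul _]
    refine Finset.sum_congr rfl fun y _ => ?_
    rw [integral_const_mul, hl.eq_inv, invFourierT_eq]
  rw [Finset.sum_congr rfl h2, ← real_inner_self_eq_norm_sq, Finsupp.linearCombination_apply,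
    Finsupp.sum, sum_inner]
  simp_rw [inner_sum, inner_smul_left, inner_smul_right]
  push_cast
  refine Finset.sum_congr rfl fun x _ => Finset.sum_congr rfl fun y _ => ?_
  rw [RKHS.kerFun_inner, RKHS.kerFun_apply, hH]
  simp
  ring

/-- The Cauchy–Schwarz inequality on a set of finite measure. -/
lemma setIntegral_norm_le_sqrt {α : Type*} [MeasurableSpace α] {μ : Measure α} {s : Set α}
    (hs : μ s ≠ ⊤) {f : α → ℂ} (hf : MemLp f 2 (μ.restrict s)) :
    ∫ a in s, ‖f a‖ ∂μ ≤ √(μ.real s) * √(∫ a in s, ‖f a‖ ^ 2 ∂μ) := by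
  have : IsFiniteMeasure (μ.restrict s) := ⟨by simpa using hs.lt_top⟩
  have h := integral_mul_norm_le_Lp_mul_Lq (μ := μ.restrict s) (f := fun _ => (1 : ℂ)) (g := f)
    Real.HolderConjugate.two_two (by simpa using memLp_const 1) (by simpa using hf)
  simpa [Real.sqrt_eq_rpow] using h

/-- A combination of point values of the candidate is the integral of `expSum z * u` over the
compact band. Cauchy–Schwarz bounds it by the `L²` norm of `expSum z` there, and `l ≥ δ` bounds that
by the RKHS norm of the corresponding kernel combination. -/
lemma exists_rkhs_of_fourierInv {lam l : E d → ℝ} (hl : IsSpectralDensity lam l)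
    {H : Type} [NormedAddCommGroup H] [InnerProductSpace ℝ H] [CompleteSpace H]
    [RKHS ℝ H (E d) ℝ] (hH : HasReproducingKernel lam H) {R δ : ℝ} (hδ : 0 < δ)
    (hlow : ∀ᵐ ω : E d, ω ∈ cube d R → δ ≤ l ω) {u : E d → ℂ} (hu : Integrable u) {B : ℝ}
    (hB : ∀ ξ, ‖u ξ‖ ≤ B) (hsupp : ∀ ξ : E d, (∃ j, R < 2 * Real.pi * |ξ j|) → u ξ = 0) :
    ∃ f : H, ∀ x, f x = (𝓕⁻ u x).re := by
  set s : Set (E d) := {ξ | ∀ j, 2 * Real.pi * |ξ j| ≤ R} with hs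
  have hsc : IsCompact s := isCompact_band R
  have hsm : MeasurableSet s := hsc.measurableSet
  have hB0 : 0 ≤ B := (norm_nonneg _).trans (hB 0)
  refine exists_coe_eq_of_bound _ (B * √(volume.real s) * √(δ⁻¹)) fun z => ?_
  set N := ‖Finsupp.linearCombination ℝ (fun x => RKHS.kerFun H x (1 : ℝ)) z‖ with hN
  have hL : Finsupp.linearCombination ℝ (fun x => (𝓕⁻ u x).re) z =
      (∫ ξ in s, expSum z ξ * u ξ).re := by
    have h1 : ∫ ξ in s, expSum z ξ * u ξ = ∫ ξ, expSum z ξ * u ξ :=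
      setIntegral_eq_integral_of_forall_compl_eq_zero fun ξ hξ => by
        simp only [hs, Set.mem_ofPred_eq, not_forall, not_le] at hξ
        rw [hsupp ξ hξ, mul_zero]
    have h2 : ∀ x : E d, Integrable fun ξ : E d =>
        Complex.exp (((2 * Real.pi * inner ℝ x ξ : ℝ) : ℂ) * Complex.I) * u ξ := fun x => by
      have := integrable_character_mul hu x (2 * Real.pi)
      simpa only [real_inner_comm] using this
    have h3 : ∀ ξ, expSum z ξ * u ξ = ∑ x ∈ z.support, (z x : ℂ) *
        (Complex.exp (((2 * Real.pi * inner ℝ x ξ : ℝ) : ℂ) * Complex.I) * u ξ) := fun ξ => by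
      rw [expSum, Finsupp.sum, Finset.sum_mul]
      exact Finset.sum_congr rfl fun _ _ => mul_assoc _ _ _
    rw [h1]
    simp_rw [h3]
    rw [integral_finsetSum _ fun x _ => (h2 x).const_mul _, Complex.re_sum,
      Finsupp.linearCombination_apply, Finsupp.sum]
    refine Finset.sum_congr rfl fun x _ => ?_
    rw [integral_const_mul, Complex.re_ofReal_mul, smul_eq_mul, Real.fourierInv_eq']
    congr 2
    refine integral_congr_ae (Filter.Eventually.of_forall fun ξ => ?_)
    simp only [smul_eq_mul, real_inner_comm]
  have hcont := continuous_expSum z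
  have hfin : IsFiniteMeasure (volume.restrict s) := ⟨by simpa using hsc.measure_lt_top⟩
  have hmem : MemLp (expSum z) 2 (volume.restrict s) :=
    MemLp.of_bound hcont.aestronglyMeasurable _ (Filter.Eventually.of_forall (norm_expSum_le z))
  have h1 : ‖∫ ξ in s, expSum z ξ * u ξ‖ ≤ B * ∫ ξ in s, ‖expSum z ξ‖ := by
    rw [← integral_const_mul]
    refine norm_integral_le_of_norm_le ((hmem.integrable (by norm_num)).norm.const_mul B)
      (Filter.Eventually.of_forall fun ξ => ?_)
    rw [norm_mul, mul_comm]
    exact mul_le_mul_of_nonneg_right (hB ξ) (norm_nonneg _)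
  have h2 := setIntegral_norm_le_sqrt (μ := volume) hsc.measure_lt_top.ne hmem
  have hlint : Integrable fun ξ : E d => ‖expSum z ξ‖ ^ 2 * l ((2 * Real.pi) • ξ) := by
    refine (hl.integrable.comp_smul (by positivity : 2 * Real.pi ≠ 0)).bdd_mul
      (c := (z.sum fun _ a => |a|) ^ 2) (hcont.norm.pow 2).aestronglyMeasurable
      (Filter.Eventually.of_forall fun ξ => ?_)
    rw [norm_pow, norm_norm]
    exact pow_le_pow_left₀ (norm_nonneg _) (norm_expSum_le z ξ) 2
  have hlow' : ∀ᵐ ξ : E d, (2 * Real.pi) • ξ ∈ cube d R → δ ≤ l ((2 * Real.pi) • ξ) :=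
    (Measure.quasiMeasurePreserving_smul volume (by positivity : 2 * Real.pi ≠ 0)).ae hlow
  have h3 : ∫ ξ in s, ‖expSum z ξ‖ ^ 2 ≤ δ⁻¹ * N ^ 2 := by
    rw [hN, norm_sq_linearCombination_kerFun hl hH, ← integral_const_mul]
    refine le_trans ?_ (setIntegral_le_integral (s := s) (hlint.const_mul _)
      (Filter.Eventually.of_forall fun ξ => mul_nonneg (inv_nonneg.2 hδ.le)
        (mul_nonneg (sq_nonneg _) (hl.nonneg _))))
    refine integral_mono_ae (hmem.integrable_norm_pow (by norm_num)) (hlint.const_mul _).integrableOn ?_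
    filter_upwards [ae_restrict_of_ae hlow', ae_restrict_mem hsm] with ξ h1 h2
    have h4 : δ ≤ l ((2 * Real.pi) • ξ) := h1 fun j => by
      rw [PiLp.smul_apply, smul_eq_mul, abs_mul, abs_of_pos (by positivity)]
      exact h2 j
    rw [← div_eq_inv_mul, le_div_iff₀ hδ]
    exact mul_le_mul_of_nonneg_left h4 (sq_nonneg _)
  rw [hL]
  calc |(∫ ξ in s, expSum z ξ * u ξ).re| ≤ ‖∫ ξ in s, expSum z ξ * u ξ‖ := Complex.abs_re_le_norm _
    _ ≤ B * (√(volume.real s) * √(δ⁻¹ * N ^ 2)) := by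
        refine h1.trans ?_
        gcongr
        exact h2.trans (by gcongr)
    _ = B * √(volume.real s) * √(δ⁻¹) * N := by
        rw [Real.sqrt_mul (inv_nonneg.2 hδ.le), Real.sqrt_sq (norm_nonneg _)]
        ring

/-- Deconvolution of a band-limited function by a kernel with nonvanishing spectrum. -/
lemma exists_isConvolution {P : E d → ℝ} {R : ℝ} (hP : IsBandLimited (fun v => (P v : ℂ)) R)
    {φ : E d → ℝ} (hφ : IsProbDensity φ) (hσ : SpectrumCovers φ R)
    {lam l : E d → ℝ} (hl : IsSpectralDensity lam l)
    (hlow : ∃ δ : ℝ, 0 < δ ∧ ∀ᵐ ω : E d, ω ∈ cube d R → δ ≤ l ω)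
    {H : Type} [NormedAddCommGroup H] [InnerProductSpace ℝ H] [CompleteSpace H]
    [RKHS ℝ H (E d) ℝ] (hH : HasReproducingKernel lam H) :
    ∃ c : H, IsConvolution φ c P := by
  obtain ⟨δ, hδ, hlow⟩ := hlow
  set s : Set (E d) := {ξ | ∀ j, 2 * Real.pi * |ξ j| ≤ R} with hs
  have hsc : IsCompact s := isCompact_band R
  have hsm : MeasurableSet s := hsc.measurableSet
  set σ : E d → ℂ := 𝓕 (fun x => (φ x : ℂ)) with hσdef
  set p : E d → ℂ := 𝓕 (fun x => (P x : ℂ)) with hp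
  have hσc : Continuous σ := continuous_fourier hφ.integrable.ofReal
  have hpc : Continuous p := continuous_fourier hP.integrable
  have hσ0 : ∀ ξ ∈ s, σ ξ ≠ 0 := fun ξ hξ => by
    rw [hσdef, fourier_eq_fourierT]
    refine hσ fun j => ?_
    rw [PiLp.smul_apply, smul_eq_mul, abs_mul, abs_of_pos (by positivity)]
    exact hξ j
  have hp0 : ∀ ξ, ξ ∉ s → p ξ = 0 := fun ξ hξ => by
    by_contra hc
    exact hξ (hP.support_fourier_subset hc)
  -- The spectrum of the deconvolved function: `σ` is continuous and nonzero on the compact band, so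
  -- the quotient is bounded there.
  set u : E d → ℂ := s.indicator fun ξ => p ξ / σ ξ with hu
  have hcont : ContinuousOn (fun ξ => p ξ / σ ξ) s :=
    hpc.continuousOn.div hσc.continuousOn hσ0
  have huint : Integrable u := (hcont.integrableOn_compact hsc).integrable_indicator hsm
  obtain ⟨B, hB⟩ := hsc.exists_bound_of_continuousOn hcont
  have huB : ∀ ξ, ‖u ξ‖ ≤ |B| := fun ξ => by
    by_cases hξ : ξ ∈ s
    · rw [hu, Set.indicator_of_mem hξ]
      exact (hB ξ hξ).trans (le_abs_self B)
    · rw [hu, Set.indicator_of_notMem hξ, norm_zero]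
      exact abs_nonneg B
  have hσu : ∀ ξ, σ ξ * u ξ = p ξ := fun ξ => by
    by_cases hξ : ξ ∈ s
    · rw [hu, Set.indicator_of_mem hξ, mul_div_cancel₀ _ (hσ0 ξ hξ)]
    · rw [hu, Set.indicator_of_notMem hξ, mul_zero, hp0 ξ hξ]
  obtain ⟨c, hc⟩ := exists_rkhs_of_fourierInv hl hH hδ hlow huint huB fun ξ ⟨j, hj⟩ => by
    rw [hu, Set.indicator_of_notMem]
    exact fun h => absurd (h j) (not_le.2 hj)
  have hwc : Continuous (𝓕⁻ u) := by
    rw [Real.fourierInv_eq_fourier_comp_neg]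
    exact continuous_fourier huint.comp_neg
  have hwB : ∀ x, ‖𝓕⁻ u x‖ ≤ ∫ ξ, ‖u ξ‖ := fun x => by
    rw [Real.fourierInv_eq]
    refine (norm_integral_le_integral_norm _).trans_eq ?_
    simp
  have hint : ∀ x, Integrable fun y => (φ (x - y) : ℂ) * 𝓕⁻ u y := fun x =>
    (hφ.integrable.comp_sub_left x).ofReal.mul_bdd (c := ∫ ξ, ‖u ξ‖) hwc.aestronglyMeasurable
      (Filter.Eventually.of_forall hwB)
  have hre : ∀ x y, φ (x - y) * c y = ((φ (x - y) : ℂ) * 𝓕⁻ u y).re := fun x y => by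
    rw [Complex.re_ofReal_mul, hc]
  refine ⟨c, fun x => ⟨?_, ?_⟩⟩
  · simp_rw [hre]
    exact (hint x).re
  · simp_rw [hre]
    have h1 : ∫ y, ((φ (x - y) : ℂ) * 𝓕⁻ u y) = P x := by
      rw [← integral_sub_left_eq_self _ volume x]
      simp only [sub_sub_cancel]
      -- Moving the transform from the modulated `u` onto `φ` turns the convolution at `x` into the
      -- inverse transform of `σ * u = p`, which is `P x`.
      have h2 := integral_fourier_mul hφ.integrable.ofReal
        (integrable_character_mul huint x (2 * Real.pi))
      have h3 : ∀ y, 𝓕 (fun ξ => Complex.exp (((2 * Real.pi * inner ℝ ξ x : ℝ) : ℂ) * Complex.I) *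
          u ξ) y = 𝓕⁻ u (x - y) := fun y => by
        rw [Real.fourier_eq', Real.fourierInv_eq']
        refine integral_congr_ae (Filter.Eventually.of_forall fun ξ => ?_)
        simp only [smul_eq_mul, ← mul_assoc, ← Complex.exp_add, inner_sub_right]
        congr 2
        push_cast
        ring
      simp_rw [h3] at h2
      refine h2.symm.trans ?_
      have h4 := congrFun hP.fourierInv_fourier x
      rw [← h4, Real.fourierInv_eq']
      refine integral_congr_ae (Filter.Eventually.of_forall fun ξ => ?_)
      simp only [smul_eq_mul]
      rw [mul_left_comm]
      exact congrArg _ (hσu ξ)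
    have h5 := integral_re (hint x)
    simp only [RCLike.re_eq_complex_re] at h5
    rw [h5, h1, Complex.ofReal_re]

end Deconvolution

/-! ### Return to the original scale, norm bound and conclusion. -/

section Assembly

variable {d K : ℕ}

lemma psiM_eq (m : ℕ) : (psiM m : E d → ℝ) = fun u => partialD 0 ((m : ℝ) • u) := by
  funext u
  rw [psiM, partialD_zero]

lemma inner_gradient_psiM (m : ℕ) (u b : E d) :
    inner ℝ b (gradient (psiM m) u) =
      m * ∑ i, b i * partialD (Pi.single i 1) ((m : ℝ) • u) := by
  have h1 : HasFDerivAt (fun u : E d => (m : ℝ) • u) ((m : ℝ) • ContinuousLinearMap.id ℝ (E d)) u :=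
    (hasFDerivAt_id u).const_smul (m : ℝ)
  have h2 := (hasFDerivAt_partialD (0 : Fin d → ℕ) ((m : ℝ) • u)).comp u h1
  change HasFDerivAt (fun u : E d => partialD 0 ((m : ℝ) • u)) _ u at h2
  rw [← psiM_eq] at h2
  rw [gradient, real_inner_comm, InnerProductSpace.toDual_symm_apply, h2.fderiv]
  simp [Finset.mul_sum]
  exact Finset.sum_congr rfl fun i _ => by ring

/-- The factor `m⁻¹` in the gradient coefficients cancels the `m` produced by differentiating `psiM
m`. -/
lemma pM_eq_interpolant {m : ℕ} (hm : 1 ≤ m) (t : Fin K → E d)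
    (x : Fin K × Option (Fin d) → ℝ) (s : E d) :
    pM m t (fun k => x (k, none))
      (fun k => WithLp.toLp 2 fun i => (m : ℝ)⁻¹ * x (k, some i)) s =
      interpolant (fun k => (m : ℝ) • t k) x 0 ((m : ℝ) • s) := by
  have hm0 : (m : ℝ) ≠ 0 := by positivity
  rw [pM, interpolant, Fintype.sum_prod_type]
  refine Finset.sum_congr rfl fun k _ => ?_
  rw [inner_gradient_psiM, psiM_eq, Fintype.sum_option, Finset.mul_sum]
  simp only [optIdx_none, optIdx_some, add_zero, smul_sub]
  congr 1
  refine Finset.sum_congr rfl fun i _ => ?_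
  field_simp

lemma isBandLimited_interpolant (τ : Fin K → E d) (x : Fin K × Option (Fin d) → ℝ) :
    IsBandLimited (fun v => (interpolant τ x 0 v : ℂ)) 4 := by
  have h := IsBandLimited.sum Finset.univ (R := 4)
    (F := fun (p : Fin K × Option (Fin d)) v => (x p : ℂ) * (partialD (optIdx p.2) (v - τ p.1) : ℂ))
    fun p _ => ((isBandLimited_partialD p.2).comp_sub (τ p.1)).const_mul _
  convert h using 2
  simp [interpolant]

lemma integrable_decayProd : Integrable (decayProd : E d → ℝ) :=
  integrable_euclidean_prod (g := fun _ => decay) fun _ => integrable_decay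

lemma integral_decayProd_le : ∫ v : E d, decayProd v ≤ (2 * Real.pi) ^ d := by
  have := integral_euclidean_prod (d := d) (fun _ => decay)
  simp only [decayProd]
  rw [this, Finset.prod_const, Finset.card_univ, Fintype.card_fin]
  exact pow_le_pow_left₀ (integral_nonneg fun x => (decay_pos x).le) integral_decay_le d

lemma sepPlus_pos (t : Fin K → E d) : 0 < sepPlus t := by
  refine ENNReal.toReal_pos ?_ (ne_top_of_le_ne_top ENNReal.one_ne_top (min_le_right _ _))
  refine (lt_min ?_ one_pos).ne'
  exact (Set.finite_range t).einfsep_pos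

lemma sepPlus_le {t : Fin K → E d} (ht : Function.Injective t) {l k : Fin K} (h : l ≠ k) :
    sepPlus t ≤ ‖t l - t k‖ := by
  rw [← dist_eq_norm, dist_edist]
  exact ENNReal.toReal_mono (edist_ne_top _ _) ((min_le_left _ _).trans
    (Set.einfsep_le_edist_of_mem (Set.mem_range_self l) (Set.mem_range_self k) (ht.ne h)))

lemma separation_of_le {m : ℕ} {t : Fin K → E d} (ht : Function.Injective t)
    (h : 2 ^ 13 * √(K : ℝ) * (d : ℝ) ^ (3 / 2 : ℝ) / sepPlus t ≤ (m : ℝ)) (l k : Fin K)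
    (hlk : l ≠ k) : 2 * (sepScale d K * √d) ≤ ‖(m : ℝ) • t l - (m : ℝ) • t k‖ := by
  have hd : (d : ℝ) ^ (3 / 2 : ℝ) = d * √d := by
    rcases Nat.eq_zero_or_pos d with rfl | hd
    · norm_num
    · rw [Real.sqrt_eq_rpow, ← Real.rpow_one_add' (by positivity) (by norm_num)]
      norm_num
  rw [div_le_iff₀ (sepPlus_pos t), hd] at h
  rw [← smul_sub, norm_smul, Real.norm_natCast]
  have := mul_le_mul_of_nonneg_left (sepPlus_le ht hlk) (Nat.cast_nonneg (α := ℝ) m)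
  calc 2 * (sepScale d K * √d) = 2 ^ 13 * √(K : ℝ) * (d * √d) := by rw [sepScale]; ring
    _ ≤ _ := h.trans this

lemma eLpNorm_two_le_of_sq_bound {α : Type*} [MeasurableSpace α] {μ : Measure α} {f g : α → ℝ}
    (hf : AEStronglyMeasurable f μ) (hg : Integrable g μ) (h : ∀ a, f a ^ 2 ≤ g a) {B : ℝ}
    (hB : 0 ≤ B) (hI : ∫ a, g a ∂μ ≤ B ^ 2) : eLpNorm f 2 μ ≤ ENNReal.ofReal B := by
  have hsq : Integrable (fun a => f a ^ 2) μ := hg.mono' (hf.pow 2)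
    (Filter.Eventually.of_forall fun a => by
      rw [Real.norm_eq_abs, abs_of_nonneg (sq_nonneg _)]; exact h a)
  have hmem := (memLp_two_iff_integrable_sq hf).2 hsq
  rw [hmem.eLpNorm_eq_integral_rpow_norm (by norm_num) (by norm_num)]
  refine ENNReal.ofReal_le_ofReal ?_
  have h1 : ∫ a, ‖f a‖ ^ (2 : ℝ) ∂μ ≤ B ^ 2 := by
    refine le_trans (integral_mono ?_ hg fun a => ?_) hI
    · simpa using hsq
    · simpa using h a
  simp only [ENNReal.toReal_ofNat]
  calc (∫ a, ‖f a‖ ^ (2 : ℝ) ∂μ) ^ (2 : ℝ)⁻¹ ≤ (B ^ 2) ^ (2 : ℝ)⁻¹ :=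
        Real.rpow_le_rpow (integral_nonneg fun a => by positivity) h1 (by norm_num)
    _ = B := by
        rw [← Real.rpow_natCast, ← Real.rpow_mul hB]
        norm_num

/-- Since `|q| ≤ 1`, `q⁴ ≤ |q|`, so the integral of the decay profile bounds the squared norm; the
dilation contributes `m^(-d)`. -/
lemma eLpNorm_certificate_le {m : ℕ} (hd : 1 ≤ d) (hK : 1 ≤ K) (hm : 1 ≤ m) {τ : Fin K → E d}
    {q : E d → ℝ} (hqc : Continuous q) (hq1 : ∀ v, q v ^ 2 ≤ 1)
    (hq : ∀ v, |q v| ≤ 16 * ∑ k, decayProd (v - τ k)) :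
    eLpNorm (fun s => q ((m : ℝ) • s) ^ 2) 2 volume ≤
      ENNReal.ofReal (16 ^ d * (K : ℝ) ^ 2 * (m : ℝ) ^ (-(d : ℝ) / 2)) := by
  have hm0 : (0 : ℝ) < m := by positivity
  have hK1 : (1 : ℝ) ≤ K := by exact_mod_cast hK
  have hint : Integrable fun v : E d => 16 * ∑ k, decayProd (v - τ k) :=
    (integrable_finsetSum _ fun k _ => integrable_decayProd.comp_sub_right (τ k)).const_mul 16
  refine eLpNorm_two_le_of_sq_bound
    (g := fun s => 16 * ∑ k, decayProd ((m : ℝ) • s - τ k))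
    (Continuous.aestronglyMeasurable (by fun_prop)) (hint.comp_smul hm0.ne') (fun s => ?_)
    (by positivity) ?_
  · refine le_trans ?_ (hq _)
    have h1 := hq1 ((m : ℝ) • s)
    have h2 : |q ((m : ℝ) • s)| ≤ 1 := (sq_le_one_iff_abs_le_one _).1 h1
    calc (q ((m : ℝ) • s) ^ 2) ^ 2 ≤ q ((m : ℝ) • s) ^ 2 :=
          pow_le_of_le_one (sq_nonneg _) h1 (by norm_num)
      _ = |q ((m : ℝ) • s)| ^ 2 := (sq_abs _).symm
      _ ≤ _ := pow_le_of_le_one (abs_nonneg _) h2 (by norm_num)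
  · rw [Measure.integral_comp_smul volume (fun v : E d => 16 * ∑ k, decayProd (v - τ k)),
      integral_const_mul,
      integral_finsetSum _ fun k _ => integrable_decayProd.comp_sub_right (τ k)]
    simp_rw [integral_sub_right_eq_self (fun v : E d => decayProd v)]
    have hfin : Module.finrank ℝ (E d) = d := by simp
    rw [hfin, abs_of_pos (by positivity), Finset.sum_const, Finset.card_univ, Fintype.card_fin,
      nsmul_eq_mul, smul_eq_mul]
    have hmd : ((m : ℝ) ^ (-(d : ℝ) / 2)) ^ 2 = ((m : ℝ) ^ d)⁻¹ := by
      rw [← Real.rpow_natCast, ← Real.rpow_mul hm0.le, ← Real.rpow_natCast, ← Real.rpow_neg hm0.le]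
      congr 1
      push_cast
      ring
    rw [mul_pow, hmd, mul_comm]
    refine mul_le_mul_of_nonneg_right ?_ (by positivity)
    have h1 : (2 * Real.pi) ^ d ≤ 16 ^ d :=
      pow_le_pow_left₀ (by positivity) (by linarith [Real.pi_le_four]) d
    have h2 : (16 : ℝ) ≤ 16 ^ d := le_self_pow₀ (by norm_num) (by omega)
    have h3 : (K : ℝ) ≤ (K ^ 2) ^ 2 := by
      rw [← pow_mul]; exact le_self_pow₀ hK1 (by norm_num)
    calc 16 * (K * ∫ v : E d, decayProd v) ≤ 16 ^ d * ((K ^ 2) ^ 2 * 16 ^ d) := by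
          have := integral_decayProd_le (d := d)
          have h0 : 0 ≤ ∫ v : E d, decayProd v := integral_nonneg fun v => (decayProd_pos v).le
          gcongr
          exact this.trans h1
      _ = _ := by ring

/-- The quadratic `q² - (1 - z)` is convex in `q` and nonpositive at both ends: `(1 - z)² ≤ 1 - z`
and `49 / 64 ≤ 7 / 8 ≤ 1 - z`. -/
lemma sq_le_of_bounds {q z : ℝ} (h1 : -(7 / 8) ≤ q) (h2 : q ≤ 1 - z) (h3 : 0 ≤ z)
    (h4 : z ≤ 1 / 8) : q ^ 2 ≤ 1 - z := by
  nlinarith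

end Assembly

end StrongCertificate

theorem theorem7 :
    ∃ C υ γ c A : ℝ, 0 < C ∧ 0 < υ ∧ 0 < γ ∧ 0 < c ∧ 0 < A ∧
      ∀ (d K m : ℕ) (t : Fin K → E d), 1 ≤ d → 1 ≤ K → 1 ≤ m → Function.Injective t →
        C * √(K : ℝ) * (d : ℝ) ^ (3 / 2 : ℝ) / sepPlus t ≤ (m : ℝ) →
        ∃ (α : Fin K → ℝ) (β : Fin K → E d) (P : E d → ℝ),
          (∀ s, P s = pM m t α β s ^ 2) ∧
          -- (i) interpolation
          ((∀ k, P (t k) = 1) ∧ (∀ s, 0 ≤ P s ∧ P s ≤ 1) ∧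
            (∀ s, P s = 1 ↔ s ∈ Set.range t)) ∧
          -- (ii) near and far regions
          ((∀ k, ∀ s ∈ nearRegion t (υ / (m * d)) k,
              0 ≤ P s ∧ P s ≤ 1 - c * (m : ℝ) ^ 2 * ‖s - t k‖ ^ 2) ∧
            (∀ s ∈ farRegion t (υ / (m * d)),
              0 ≤ P s ∧ P s ≤ 1 - γ * (υ ^ 2 / (d : ℝ) ^ 3))) ∧
          -- (iii) frequency support and size
          (Integrable P ∧ tsupport (fourierT P) ⊆ cube d (8 * m) ∧
            eLpNorm P 2 volume ≤
              ENNReal.ofReal (A ^ d * (K : ℝ) ^ 2 * (m : ℝ) ^ (-(d : ℝ) / 2))) ∧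
          -- (iv) the certificate is in the range of the convolution operator on the RKHS
          (∀ φ : E d → ℝ, IsPosDefKernel φ → IsProbDensity φ → SpectrumCovers φ (8 * m) →
            ∀ lam l : E d → ℝ, IsPosDefKernel lam → IsSpectralDensity lam l →
              (∃ δ : ℝ, 0 < δ ∧ ∀ᵐ ω : E d, ω ∈ cube d (8 * m) → δ ≤ l ω) →
              ∀ (H : Type) [NormedAddCommGroup H] [InnerProductSpace ℝ H] [CompleteSpace H]
                [RKHS ℝ H (E d) ℝ], HasReproducingKernel lam H →
                ∃ cm : H, IsConvolution φ cm P) := by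
  -- `2 ^ 13` is twice the constant in `sepScale`. The radius, far and near constants are those of
  -- `interpolant_far` and `interpolant_near`; 16 dominates both `2π` and the prefactor of the decay
  -- bound.
  refine ⟨2 ^ 13, 1 / 2048, 1 / 96, 1 / 8, 16, by norm_num, by norm_num, by norm_num, by norm_num,
    by norm_num, fun d K m t hd hK hm ht hsize => ?_⟩
  have hm0 : (0 : ℝ) < m := by positivity
  have hd1 : (1 : ℝ) ≤ d := by exact_mod_cast hd
  have hd0 : (0 : ℝ) < d := by linarith
  set τ : Fin K → E d := fun k => (m : ℝ) • t k with hτ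
  have hsep : ∀ l k, l ≠ k → 2 * (sepScale d K * √d) ≤ ‖τ l - τ k‖ :=
    separation_of_le ht hsize
  have hscale := sepScale_ge_one hd hK
  obtain ⟨x, hint, hx⟩ := exists_interpolant τ (h := (sepScale d K ^ 4)⁻¹) (by positivity)
    (fun l k hlk => decayProd_le_of_le_norm hd _ (by linarith)
      (by nlinarith [hsep l k hlk, Real.sqrt_nonneg (d : ℝ)])) (small_le hd hK)
  set q : E d → ℝ := interpolant τ x 0 with hq
  have hnorm : ∀ s k, ‖(m : ℝ) • s - τ k‖ = m * ‖s - t k‖ := fun s k => by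
    rw [hτ, ← smul_sub, norm_smul, Real.norm_natCast]
  have hrad : ∀ r : ℝ, r ≤ 1 / 2048 / (m * d) ↔ m * r ≤ 1 / (2048 * d) := fun r => by
    rw [div_div, le_div_iff₀ (by positivity), le_div_iff₀ (by positivity)]
    constructor <;> intro h <;> linarith
  have hnear : ∀ k, ∀ s ∈ nearRegion t (1 / 2048 / (m * d)) k,
      q ((m : ℝ) • s) ^ 2 ≤ 1 - 1 / 8 * (m : ℝ) ^ 2 * ‖s - t k‖ ^ 2 := by
    intro k s hs
    have hs' : ‖(m : ℝ) • s - τ k‖ ≤ 1 / (2048 * d) := by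
      rw [hnorm]; exact (hrad _).1 hs
    obtain ⟨h1, h2⟩ := interpolant_near hd hK hsep hint hx k _ hs'
    have h3 : 1 / (2048 * (d : ℝ)) ≤ 1 := by rw [div_le_one (by positivity)]; linarith
    have h4 : ‖(m : ℝ) • s - τ k‖ ^ 2 ≤ 1 := pow_le_one₀ (norm_nonneg _) (hs'.trans h3)
    have h5 := sq_le_of_bounds h1 h2 (by positivity) (by linarith)
    rw [hnorm, mul_pow, ← mul_assoc] at h5
    exact h5
  have hfar : ∀ s ∈ farRegion t (1 / 2048 / (m * d)),
      q ((m : ℝ) • s) ^ 2 ≤ 1 - 1 / 96 * ((1 / 2048) ^ 2 / (d : ℝ) ^ 3) := by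
    intro s hs
    have hs' : ∀ k, 1 / (2048 * d) < ‖(m : ℝ) • s - τ k‖ := fun k => by
      rw [hnorm]
      by_contra hc
      exact hs (Set.mem_iUnion.2 ⟨k, (hrad _).2 (not_lt.1 hc)⟩)
    obtain ⟨h1, h2⟩ := interpolant_far hd hK hsep hx _ hs'
    refine sq_le_of_bounds h1 h2 (by positivity) ?_
    have : (1 / 2048 : ℝ) ^ 2 / (d : ℝ) ^ 3 ≤ (1 / 2048) ^ 2 :=
      div_le_self (by positivity) (one_le_pow₀ hd1)
    norm_num at this ⊢
    linarith
  have hone : ∀ k, q ((m : ℝ) • t k) ^ 2 = 1 := fun k => by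
    have := hint k none
    rw [optIdx_none] at this
    rw [hq, this]
    simp [target]
  have hle : ∀ s, q ((m : ℝ) • s) ^ 2 ≤ 1 ∧ (q ((m : ℝ) • s) ^ 2 = 1 → s ∈ Set.range t) := by
    intro s
    by_cases hs : ∃ k, s ∈ nearRegion t (1 / 2048 / (m * d)) k
    · obtain ⟨k, hk⟩ := hs
      have h1 := hnear k s hk
      refine ⟨h1.trans (sub_le_self _ (by positivity)), fun h => ⟨k, ?_⟩⟩
      have h2 : (m : ℝ) ^ 2 * ‖s - t k‖ ^ 2 ≤ 0 := by linarith
      have h3 : ‖s - t k‖ ^ 2 = 0 := le_antisymm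
        (nonpos_of_mul_nonpos_right h2 (by positivity)) (sq_nonneg _)
      exact (sub_eq_zero.1 (norm_eq_zero.1 (pow_eq_zero_iff two_ne_zero |>.1 h3))).symm
    · have h1 := hfar s fun h => hs (Set.mem_iUnion.1 h)
      have h2 : 0 < 1 / 96 * ((1 / 2048 : ℝ) ^ 2 / (d : ℝ) ^ 3) := by positivity
      exact ⟨by linarith, fun h => absurd h (by linarith)⟩
  have hq1 : ∀ v, q v ^ 2 ≤ 1 := fun v => by
    simpa [smul_smul, mul_inv_cancel₀ hm0.ne'] using (hle ((m : ℝ)⁻¹ • v)).1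
  have hband : IsBandLimited (fun s => ((q ((m : ℝ) • s) ^ 2 : ℝ) : ℂ)) (8 * m) := by
    have h1 := isBandLimited_interpolant τ x
    have h2 := (h1.mul h1 (M := 1) fun v => by
      rw [Complex.norm_real, Real.norm_eq_abs]
      exact (sq_le_one_iff_abs_le_one _).1 (hq1 v)).comp_smul hm0
    norm_num at h2
    simpa only [sq, Complex.ofReal_mul] using h2
  have hqc : Continuous q := by
    have := Complex.continuous_re.comp (isBandLimited_interpolant τ x).continuous
    simpa [Function.comp_def] using this
  refine ⟨fun k => x (k, none), fun k => WithLp.toLp 2 fun i => (m : ℝ)⁻¹ * x (k, some i),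
    fun s => q ((m : ℝ) • s) ^ 2, fun s => ?_, ⟨hone, fun s => ⟨sq_nonneg _, (hle s).1⟩,
    fun s => ⟨(hle s).2, ?_⟩⟩, ⟨fun k s hs => ⟨sq_nonneg _, hnear k s hs⟩,
    fun s hs => ⟨sq_nonneg _, hfar s hs⟩⟩, ⟨?_, hband.tsupport_fourierT_subset,
    eLpNorm_certificate_le hd hK hm hqc hq1 (abs_interpolant_le hd hK hx)⟩, ?_⟩
  · exact congrArg (· ^ 2) (pM_eq_interpolant hm t x s).symm
  · rintro ⟨k, rfl⟩
    exact hone k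
  · exact hband.integrable.re
  · intro φ _ hφ hσ lam l _ hl hlow H _ _ _ _ hH
    exact exists_isConvolution hband hφ hσ hl hlow hH
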